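/- Let $k\ge 0$ and let $\lambda=(\lambda_1,\lambda_2,\dots)\vdash k$ be a partition. All representations are complex, and $V^{\mu}$ denotes the irreducible representation (Specht module) of $S_n$ attached to $\mu\vdash n$, so that $V^{(n)}$ is trivial and $V^{(1^n)}$ is the sign representation. Put $d_\lambda=\dim V^\lambda$ and $\lambda^+(2k)=(k,\lambda_1,\lambda_2,\dots)\vdash 2k$. Let $s_i=(i\ \,i{+}1)\in S_{2k}$, let $\psi:S_k\to S_{2k}$ be the injective homomorphism permuting the consecutive pairs $\{1,2\},\{3,4\},\dots,\{2k-1,2k\}$, i.e. $\psi(\sigma)(2i-1)=2\sigma(i)-1$ and $\psi(\sigma)(2i)=2\sigma(i)$, let $\mathcal D=\langle s_1,s_3,\dots,s_{2k-1}\rangle$, and let $H_k=\langle\psi(S_k),s_1,s_3,\dots,s_{2k-1}\rangle=\psi(S_k)\ltimes\mathcal D\le S_{2k}$ be the hyperoctahedral group. Let $W^{\emptyset,\lambda}$ be the representation of $H_k$ on the space of $V^\lambda$ in which $\psi(\sigma)\delta$ ($\sigma\in S_k$, $\delta\in\mathcal D$) acts as $\operatorname{sgn}(\delta)\,\sigma$.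 Then: (1) $W^{\emptyset,\lambda}$ is irreducible, and it occurs with multiplicity exactly $1$ in the decomposition into irreducible representations of the restriction of $V^{\lambda^+(2k)}$ from $S_{2k}$ to $H_k$. (2) Equivalently, in the unique expansion $s_\lambda\circ e_2=\sum_{\pi}c_\pi s_\pi$ of the plethysm of the Schur function $s_\lambda$ with the elementary symmetric function $e_2$ in the basis of Schur functions, the coefficient of $s_{\lambda^+(2k)}$ is $1$. (Here $s_\lambda\circ e_2$ is obtained by substituting the monomials $x_ix_j$, $i<j$, for the variables of $s_\lambda$.) (3) The sign-isotypic part $\{v\in V^{\lambda^+(2k)}:\ \delta v=\operatorname{sgn}(\delta)v\ \text{ for all }\delta\in\mathcal D\}$ of $\mathcal D$ in $V^{\lambda^+(2k)}$ has dimension $d_\lambda$. -/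

import Mathlib

/-! ### Irreducible representations of symmetric groups (Specht modules) -/

/-- The permutation representation of `S_n` on formal `ℂ`-combinations of row assignments
`r : Fin n → ℕ`, where `(g • r) i = r (g⁻¹ i)`.  A row assignment records, for each label `i`, the
row that contains it; those with `λ_j` labels in row `j` are the tabloids of shape `λ`. -/
noncomputable def tabloidRep (n : ℕ) :
    Representation ℂ (Equiv.Perm (Fin n)) ((Fin n → ℕ) →₀ ℂ) where
  toFun g := Finsupp.lmapDomain ℂ ℂ (fun r : Fin n → ℕ => fun i => r (g⁻¹ i))
  map_one' := by
    ext r : 2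
    simp
  map_mul' g h := by
    ext r : 2
    simp [Finsupp.mapDomain_single, mul_inv_rev]

/-- The polytabloid `e_t = ∑_{σ ∈ C_t} sgn(σ) σ{t}` of a bijective filling of the diagram `μ` by
the labels `Fin n`.  The filling is given as the map `t` sending a label to its cell, `{t}` is its
tabloid, and `C_t` is the group of permutations that preserve the columns of `t`. -/
noncomputable def polytabloid {n : ℕ} {μ : YoungDiagram} (t : Fin n ≃ {c // c ∈ μ.cells}) :
    (Fin n → ℕ) →₀ ℂ :=
  ∑ σ : Equiv.Perm (Fin n) with ∀ i, (t (σ i)).1.2 = (t i).1.2,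
    ((Equiv.Perm.sign σ : ℤ) : ℂ) • tabloidRep n σ (Finsupp.single (fun i => (t i).1.1) 1)

theorem tabloidRep_polytabloid {n : ℕ} {μ : YoungDiagram} (t : Fin n ≃ {c // c ∈ μ.cells})
    (g : Equiv.Perm (Fin n)) :
    tabloidRep n g (polytabloid t) = polytabloid (g⁻¹.trans t : Fin n ≃ {c // c ∈ μ.cells}) := by
  unfold polytabloid
  rw [map_sum]
  refine Finset.sum_bij' (fun σ _ => g * σ * g⁻¹) (fun σ _ => g⁻¹ * σ * g) ?_ ?_ ?_ ?_ ?_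
  · intro σ hσ
    simp only [Finset.mem_filter, Finset.mem_univ, true_and] at hσ ⊢
    intro i
    simpa using hσ (g⁻¹ i)
  · intro σ hσ
    simp only [Finset.mem_filter, Finset.mem_univ, true_and] at hσ ⊢
    intro i
    simpa using hσ (g i)
  · intro σ _
    group
  · intro σ _
    group
  · intro σ _
    have hs : Equiv.Perm.sign (g * σ * g⁻¹) = Equiv.Perm.sign σ := by
      rw [map_mul, map_mul, map_inv, mul_comm, inv_mul_cancel_left]
    have hr : Finsupp.single (fun i => ((g⁻¹.trans t : Fin n ≃ {c // c ∈ μ.cells}) i).1.1) (1 : ℂ)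
        = tabloidRep n g (Finsupp.single (fun i => (t i).1.1) 1) := by
      simp [tabloidRep, Finsupp.mapDomain_single]
    rw [hs, hr, map_smul, ← Module.End.mul_apply, ← Module.End.mul_apply, ← map_mul, ← map_mul]
    congr 3
    group

/-- The Specht module of shape `μ`, the span of all polytabloids of shape `μ`. -/
noncomputable def spechtModule (n : ℕ) (μ : YoungDiagram) : Subrepresentation (tabloidRep n) where
  toSubmodule := Submodule.span ℂ
    (Set.range fun t : Fin n ≃ {c // c ∈ μ.cells} => polytabloid t)
  apply_mem_toSubmodule g v hv := by
    induction hv using Submodule.span_induction with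
    | mem x hx =>
      obtain ⟨t, rfl⟩ := hx
      rw [tabloidRep_polytabloid]
      exact Submodule.subset_span ⟨_, rfl⟩
    | zero => simp
    | add x y _ _ hx hy => rw [map_add]; exact Submodule.add_mem _ hx hy
    | smul a x _ hx => rw [map_smul]; exact Submodule.smul_mem _ a hx

/-- The space of the representation `V^μ` of `S_n`. -/
def SpechtSpace (n : ℕ) (μ : YoungDiagram) : Type := (spechtModule n μ).toSubmodule

noncomputable instance spechtSpace_addCommGroup (n : ℕ) (μ : YoungDiagram) :
    AddCommGroup (SpechtSpace n μ) :=
  inferInstanceAs (AddCommGroup (spechtModule n μ).toSubmodule)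

noncomputable instance spechtSpace_module (n : ℕ) (μ : YoungDiagram) :
    Module ℂ (SpechtSpace n μ) :=
  inferInstanceAs (Module ℂ (spechtModule n μ).toSubmodule)

/-- The irreducible representation `V^μ` of `S_n` attached to a diagram `μ` with `n` boxes. -/
noncomputable def spechtRep (n : ℕ) (μ : YoungDiagram) :
    Representation ℂ (Equiv.Perm (Fin n)) (SpechtSpace n μ) :=
  (spechtModule n μ).toRepresentation

/-- The diagram `μ⁺(n) = (n - |μ|, μ₁, μ₂, …)`. -/
def plusDiagram (μ : YoungDiagram) (n : ℕ) (h : 2 * μ.card ≤ n) : YoungDiagram :=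
  YoungDiagram.ofRowLens ((n - μ.card) :: μ.rowLens) <| by
    refine List.Pairwise.sortedGE (List.pairwise_cons.2 ⟨?_, μ.rowLens_sorted.pairwise⟩)
    intro x hx
    obtain ⟨i, -, rfl⟩ := List.mem_map.1 hx
    have h1 : μ.rowLen i ≤ μ.card := by
      rw [YoungDiagram.rowLen_eq_card]
      exact Finset.card_le_card (Finset.filter_subset _ _)
    omega

/-! ### The hyperoctahedral group -/

/-- Position `j` of the `i`-th consecutive pair; `(i, j) ↦ 2 i + j`. -/
def pairEquiv (k : ℕ) : Fin k × Fin 2 ≃ Fin (2 * k) :=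
  finProdFinEquiv.trans (finCongr (Nat.mul_comm k 2))

/-- The embedding `ψ : S_k → S_{2k}` permuting consecutive pairs; it sends the Coxeter generator
`(i i+1)` to `(2i-1 2i+1)(2i 2i+2)` in labels starting from `1`. -/
def psi (k : ℕ) : Equiv.Perm (Fin k) →* Equiv.Perm (Fin (2 * k)) where
  toFun σ := (pairEquiv k).permCongr (Equiv.prodCongr σ (Equiv.refl (Fin 2)))
  map_one' := by
    ext x
    simp [Equiv.permCongr_apply]
  map_mul' σ τ := by
    ext x
    simp [Equiv.permCongr_apply, Prod.map]

/-- The transposition exchanging the two elements of the `i`-th consecutive pair. -/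
def pairSwap (k : ℕ) (i : Fin k) : Equiv.Perm (Fin (2 * k)) :=
  Equiv.swap (pairEquiv k (i, 0)) (pairEquiv k (i, 1))

/-- `𝒟 = ⟨s_1, s_3, …, s_{2k-1}⟩`. -/
def pairSwapGroup (k : ℕ) : Subgroup (Equiv.Perm (Fin (2 * k))) :=
  Subgroup.closure (Set.range (pairSwap k))

/-- The hyperoctahedral group `H_k = ⟨ψ(S_k), s_1, s_3, …, s_{2k-1}⟩ ≤ S_{2k}`. -/
def hyperoctahedral (k : ℕ) : Subgroup (Equiv.Perm (Fin (2 * k))) :=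
  Subgroup.closure (Set.range (psi k) ∪ Set.range (pairSwap k))

theorem psi_pairEquiv {k : ℕ} (σ : Equiv.Perm (Fin k)) (p : Fin k × Fin 2) :
    psi k σ (pairEquiv k p) = pairEquiv k (σ p.1, p.2) := by
  simp [psi, Equiv.permCongr_apply, Prod.map]

theorem psi_pairEquiv_fst {k : ℕ} (σ : Equiv.Perm (Fin k)) (p : Fin k × Fin 2) :
    ((pairEquiv k).symm (psi k σ (pairEquiv k p))).1 = σ p.1 := by
  rw [psi_pairEquiv, Equiv.symm_apply_apply]

theorem pairSwap_fst {k : ℕ} (i : Fin k) (p : Fin k × Fin 2) :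
    ((pairEquiv k).symm (pairSwap k i (pairEquiv k p))).1 = p.1 := by
  unfold pairSwap
  rw [Equiv.swap_apply_def]
  split_ifs with h1 h2
  · rw [(pairEquiv k).injective h1, Equiv.symm_apply_apply]
  · rw [(pairEquiv k).injective h2, Equiv.symm_apply_apply]
  · rw [Equiv.symm_apply_apply]

/-- Every element of `H_k` permutes the consecutive pairs. -/
theorem hyperoctahedral_blocks {k : ℕ} (h : Equiv.Perm (Fin (2 * k)))
    (hh : h ∈ hyperoctahedral k) :
    ∃ σ : Equiv.Perm (Fin k), ∀ p, ((pairEquiv k).symm (h (pairEquiv k p))).1 = σ p.1 := by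
  induction hh using Subgroup.closure_induction with
  | mem x hx =>
    rcases hx with ⟨σ, rfl⟩ | ⟨i, rfl⟩
    · exact ⟨σ, psi_pairEquiv_fst σ⟩
    · exact ⟨1, pairSwap_fst i⟩
  | one => exact ⟨1, fun p => by simp⟩
  | mul x y _ _ hx hy =>
    obtain ⟨σ, hσ⟩ := hx
    obtain ⟨τ, hτ⟩ := hy
    refine ⟨σ * τ, fun p => ?_⟩
    have := hσ ((pairEquiv k).symm (y (pairEquiv k p)))
    rw [Equiv.apply_symm_apply, hτ] at this
    exact this
  | inv x _ hx =>
    obtain ⟨σ, hσ⟩ := hx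
    refine ⟨σ⁻¹, fun p => ?_⟩
    have := hσ ((pairEquiv k).symm (x⁻¹ (pairEquiv k p)))
    rw [Equiv.apply_symm_apply, ← Equiv.Perm.mul_apply, mul_inv_cancel, Equiv.Perm.one_apply, Equiv.symm_apply_apply] at this
    rw [this, ← Equiv.Perm.mul_apply, inv_mul_cancel, Equiv.Perm.one_apply]

/-- The projection `H_k → S_k`, `ψ(σ) δ ↦ σ` for `δ ∈ 𝒟`: the action on the `k` pairs. -/
def blockPerm (k : ℕ) : hyperoctahedral k →* Equiv.Perm (Fin k) :=
  MonoidHom.toHomPerm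
    { toFun := fun h i => ((pairEquiv k).symm (h.1 (pairEquiv k (i, 0)))).1
      map_one' := by
        funext i
        simp only [OneMemClass.coe_one, Equiv.Perm.one_apply, Equiv.symm_apply_apply]
        rfl
      map_mul' := fun g h => by
        funext i
        obtain ⟨σ, hσ⟩ := hyperoctahedral_blocks g.1 g.2
        have h1 := hσ ((pairEquiv k).symm (h.1 (pairEquiv k (i, 0))))
        rw [Equiv.apply_symm_apply] at h1
        have h2 := hσ (((pairEquiv k).symm (h.1 (pairEquiv k (i, 0)))).1, 0)
        exact h1.trans h2.symm }

/-- The defining property of the projection `H_k → S_k`. -/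
theorem blockPerm_eq {k : ℕ} (h : hyperoctahedral k) (σ : Equiv.Perm (Fin k))
    (δ : Equiv.Perm (Fin (2 * k))) (hδ : δ ∈ pairSwapGroup k) (hh : h.1 = psi k σ * δ) :
    blockPerm k h = σ := by
  have key : ∀ p, ((pairEquiv k).symm (δ (pairEquiv k p))).1 = p.1 := by
    induction hδ using Subgroup.closure_induction generalizing h σ with
    | mem x hx =>
      obtain ⟨i, rfl⟩ := hx
      exact pairSwap_fst i
    | one => intro p; simp
    | mul x y hx' hy' hx hy =>
      intro p
      have hxH : x ∈ hyperoctahedral k :=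
        Subgroup.closure_mono Set.subset_union_right hx'
      have hyH : y ∈ hyperoctahedral k :=
        Subgroup.closure_mono Set.subset_union_right hy'
      have h1 := hx ⟨x, hxH⟩ 1 (by simp) ((pairEquiv k).symm (y (pairEquiv k p)))
      rw [Equiv.apply_symm_apply] at h1
      exact h1.trans (hy ⟨y, hyH⟩ 1 (by simp) p)
    | inv x hx' hx =>
      intro p
      have hxH : x ∈ hyperoctahedral k :=
        Subgroup.closure_mono Set.subset_union_right hx'
      have h1 := hx ⟨x, hxH⟩ 1 (by simp) ((pairEquiv k).symm (x⁻¹ (pairEquiv k p)))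
      rw [Equiv.apply_symm_apply, ← Equiv.Perm.mul_apply, mul_inv_cancel, Equiv.Perm.one_apply, Equiv.symm_apply_apply] at h1
      exact h1.symm
  ext1 i
  change ((pairEquiv k).symm (h.1 (pairEquiv k (i, 0)))).1 = σ i
  have h1 := psi_pairEquiv_fst σ ((pairEquiv k).symm (δ (pairEquiv k (i, 0))))
  rw [Equiv.apply_symm_apply, key] at h1
  rw [hh]
  exact h1

/-- The character `ψ(σ) δ ↦ sgn(δ)` of `H_k`, i.e. `h ↦ sgn(ψ(σ))⁻¹ sgn(h)` where `σ` is the image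
of `h` in `S_k`.  It is trivial on `ψ(S_k)` and is `-1` on each `s_1, s_3, …, s_{2k-1}`. -/
noncomputable def deltaSign (k : ℕ) : hyperoctahedral k →* ℤˣ :=
  (Equiv.Perm.sign.comp ((psi k).comp (blockPerm k)))⁻¹ *
    Equiv.Perm.sign.comp (hyperoctahedral k).subtype

/-- The representation `W^{∅,μ}` of `H_k`, for `μ` with `k` boxes: `h = ψ(σ) δ` acts on the
space of `V^μ` by `sgn(δ) σ`. -/
noncomputable def hyperoctahedralRep (k : ℕ) (μ : YoungDiagram) :
    Representation ℂ (hyperoctahedral k) (SpechtSpace k μ) where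
  toFun h := ((deltaSign k h : ℤ) : ℂ) • spechtRep k μ (blockPerm k h)
  map_one' := by simp
  map_mul' g h := by
    simp only [map_mul, Units.val_mul, Int.cast_mul, smul_mul_smul_comm]

/-- The sign-isotypic part of `𝒟` in a representation of `S_{2k}`. -/
def signIsotypic (k : ℕ) {V : Type*} [AddCommGroup V] [Module ℂ V]
    (ρ : Representation ℂ (Equiv.Perm (Fin (2 * k))) V) : Submodule ℂ V where
  carrier := {v | ∀ δ ∈ pairSwapGroup k, ρ δ v = ((Equiv.Perm.sign δ : ℤ) : ℂ) • v}
  zero_mem' := fun δ _ => by simp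
  add_mem' := fun {v w} hv hw δ hδ => by rw [map_add, hv δ hδ, hw δ hδ, smul_add]
  smul_mem' := fun a v hv δ hδ => by rw [map_smul, hv δ hδ, smul_comm]

/-- The restriction of a representation to a subgroup. -/
abbrev resRep {G V : Type*} [Group G] [AddCommGroup V] [Module ℂ V]
    (ρ : Representation ℂ G V) (H : Subgroup G) : Representation ℂ H V :=
  MonoidHom.comp ρ H.subtype

/-- The irreducible representation `τ` occurs with multiplicity exactly `m` in `ρ`: in a
decomposition of `ρ` as an internal direct sum of finitely many irreducible subrepresentations,
exactly `m` summands are isomorphic to `τ`. -/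
def OccursWithMultiplicity {G V W : Type*} [Group G] [AddCommGroup V] [Module ℂ V]
    [AddCommGroup W] [Module ℂ W] (τ : Representation ℂ G W) (ρ : Representation ℂ G V)
    (m : ℕ) : Prop :=
  ∃ (r : ℕ) (U : Fin r → Subrepresentation ρ),
    DirectSum.IsInternal (fun i => (U i).toSubmodule) ∧
    (∀ i, (U i).toRepresentation.IsIrreducible) ∧
    Nat.card {i : Fin r // Nonempty ((U i).toRepresentation.Equiv τ)} = m

/-! ### Schur polynomials and plethysm -/

/-- Semistandard tableaux of shape `μ` with entries in `{0, …, n-1}`. -/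
abbrev BoundedSSYT (μ : YoungDiagram) (n : ℕ) : Type :=
  {T : SemistandardYoungTableau μ // ∀ c ∈ μ.cells, T c.1 c.2 < n}

instance boundedSSYT_finite (μ : YoungDiagram) (n : ℕ) : Finite (BoundedSSYT μ n) := by
  refine Finite.of_injective
    (fun (T : BoundedSSYT μ n) (c : {c // c ∈ μ.cells}) => (⟨T.1 c.1.1 c.1.2, T.2 c.1 c.2⟩ : Fin n))
    fun S T h => Subtype.ext (SemistandardYoungTableau.ext fun i j => ?_)
  by_cases hc : (i, j) ∈ μ
  · exact congrArg Fin.val (congrFun h ⟨(i, j), (YoungDiagram.mem_cells _).2 hc⟩)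
  · rw [S.1.zeros hc, T.1.zeros hc]

noncomputable instance boundedSSYT_fintype (μ : YoungDiagram) (n : ℕ) :
    Fintype (BoundedSSYT μ n) := Fintype.ofFinite _

/-- The Schur polynomial `s_μ(x_0, …, x_{n-1})`, as the generating function of semistandard
tableaux. The family over all `n` is the Schur function `s_μ`. -/
noncomputable def schurPoly (μ : YoungDiagram) (n : ℕ) : MvPolynomial (Fin n) ℤ :=
  ∑ T : BoundedSSYT μ n, ∏ c : {c // c ∈ μ.cells}, MvPolynomial.X ⟨T.1 c.1.1 c.1.2, T.2 c.1 c.2⟩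

/-- The monomials of a polynomial with coefficients in `ℕ`, listed with multiplicity. -/
abbrev MonomialLetters {N : ℕ} (g : MvPolynomial (Fin N) ℕ) : Type :=
  Σ m : {m // m ∈ g.support}, Fin (g.coeff m.1)

/-- The plethysm `f ∘ g` of a symmetric function `f`, given by its polynomials `f n` in `n`
variables for all `n`, with a polynomial `g` with coefficients in `ℕ`: the monomials of `g`, listed
with multiplicity, are substituted for the variables of `f`. As `f n` is symmetric, the order of
the list is immaterial. -/
noncomputable def plethysm (f : ∀ n, MvPolynomial (Fin n) ℤ) {N : ℕ}
    (g : MvPolynomial (Fin N) ℕ) : MvPolynomial (Fin N) ℤ :=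
  MvPolynomial.aeval
    (fun i => MvPolynomial.monomial ((Fintype.equivFin (MonomialLetters g)).symm i).1.1 (1 : ℤ))
    (f (Fintype.card (MonomialLetters g)))

/-- `c` gives the coefficients of the symmetric function `f` (its polynomials in `N` variables, for
all `N`) in the basis of Schur functions: `f = ∑_π c_π s_π`. -/
def IsSchurExpansion (f : ∀ N, MvPolynomial (Fin N) ℤ) (c : YoungDiagram →₀ ℤ) : Prop :=
  ∀ N, f N = c.sum fun π a => a • schurPoly π N

/-!
Parts (1) and (3). The tabloids of shape `(k, lam)` in which the first element of every pair lies in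
row `0` and the second element lies below it correspond to the tabloids of shape `lam`: delete row
`0` and keep the second elements. Extended by zero to all other tabloids, this gives a linear map
`pairRestrict` on the permutation modules.

* It maps the Specht module of `(k, lam)` into that of `lam` (`pairRestrict_polytabloid_mem`): the
  image of a polytabloid is antisymmetric under the column group of a filling of `lam`, hence a
  multiple of the polytabloid of that filling.
* It is injective on the sign-isotypic part of `𝒟` (`eq_zero_of_pairRestrict_eq_zero`). In the
  tabloids that occur there no pair lies within one row, and row `0` has `k` places, so each pair
  has exactly one element in row `0`; the transpositions of pairs reduce to the case where this is
  always the first element.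
* The sign-isotypic part is not zero (`exists_sign_vector`).

The map commutes with `H_k` on the sign-isotypic part, and `W^{∅, lam}` is irreducible because
the Specht module of `lam` is (`spechtRep_isIrreducible`, James's submodule theorem). So the
sign-isotypic part is isomorphic to `W^{∅, lam}` (`nonempty_signIsotypicSub_equiv`), which gives its
dimension. Every copy of `W^{∅, lam}` in the restriction consists of sign-isotypic vectors, so in a
decomposition into irreducibles that contains the sign-isotypic part as a summand, which exists by
Maschke's theorem, no other summand is isomorphic to it.

Part (2). A symmetric function is treated as a rule `SymFun` that evaluates it at multisets of
elements of commutative rings. The Schur functions are defined by the branching rule `schurEval`,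
their symmetry being the Bender–Knuth involution on horizontal strips (`schurList_swap`), and they
agree with the generating functions of tableaux (`aeval_schurPoly`). The highest power of one
variable in `s_μ` has exponent `μ₁`, and its coefficient is the Schur function of `μ` without its
first row (`coeff_schurEval_rowLen_zero`). Induction on this top coefficient shows that the Schur
functions are linearly independent (`eq_zero_of_sum_smul_schurEval_eq_zero`) and that they span the
homogeneous symmetric functions (`SymFun.exists_eq_ofCoeffs`). A variable `x` enters the arguments
of `s_lam ∘ e₂` through the monomials `x y`, so that the plethysm has degree at most `k` in `x`, and
the coefficient of `x ^ k` is `s_lam` in the other variables. Comparing with the Schur expansion,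
the diagrams with first row `k` contribute the Schur functions of their remaining rows, so the
coefficient of `(k, lam)` is `1` (`SymFun.exists_plethysmE2_eq`).
-/

/-! ### Young diagrams and horizontal strips -/

namespace YoungDiagram

theorem ext_rowLen {μ ν : YoungDiagram} (h : ∀ i, μ.rowLen i = ν.rowLen i) : μ = ν := by
  refine SetLike.ext fun ⟨i, j⟩ => ?_
  rw [mem_iff_lt_rowLen, mem_iff_lt_rowLen, h]

theorem le_iff_rowLen_le {μ ν : YoungDiagram} : μ ≤ ν ↔ ∀ i, μ.rowLen i ≤ ν.rowLen i := by
  constructor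
  · intro h i
    by_contra! hlt
    have h1 : (i, ν.rowLen i) ∈ μ := mem_iff_lt_rowLen.2 hlt
    exact lt_irrefl _ (mem_iff_lt_rowLen.1 (h h1))
  · rintro h ⟨i, j⟩ hc
    exact mem_iff_lt_rowLen.2 ((mem_iff_lt_rowLen.1 hc).trans_le (h i))

theorem rowLen_colLen (μ : YoungDiagram) : μ.rowLen (μ.colLen 0) = 0 := by
  by_contra h
  have h1 : (μ.colLen 0, 0) ∈ μ := mem_iff_lt_rowLen.2 (Nat.pos_of_ne_zero h)
  exact lt_irrefl _ (mem_iff_lt_colLen.1 h1)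

theorem card_eq_sum_rowLen {μ : YoungDiagram} {n : ℕ} (h : μ.rowLen n = 0) :
    μ.card = ∑ i ∈ Finset.range n, μ.rowLen i := by
  have hmaps : ∀ c ∈ μ.cells, c.1 ∈ Finset.range n := by
    rintro ⟨i, j⟩ hc
    rw [Finset.mem_range]
    by_contra! hle
    have := mem_iff_lt_rowLen.1 ((mem_cells _).1 hc)
    have := μ.rowLen_anti n i hle
    omega
  rw [YoungDiagram.card, Finset.card_eq_sum_card_fiberwise hmaps]
  exact Finset.sum_congr rfl fun i _ => (μ.rowLen_eq_card).symm

theorem card_mono {μ ν : YoungDiagram} (h : μ ≤ ν) : μ.card ≤ ν.card :=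
  Finset.card_le_card h

theorem eq_of_le_of_card_le {μ ν : YoungDiagram} (h : μ ≤ ν) (hc : ν.card ≤ μ.card) : μ = ν :=
  YoungDiagram.ext (Finset.eq_of_subset_of_card_le h hc)

theorem card_eq_zero_iff {μ : YoungDiagram} : μ.card = 0 ↔ μ = ⊥ := by
  constructor
  · intro h
    exact YoungDiagram.ext (Finset.card_eq_zero.1 h)
  · rintro rfl
    rfl

theorem eq_bot_of_rowLen_zero {μ : YoungDiagram} (h : μ.rowLen 0 = 0) : μ = ⊥ := by
  rw [← card_eq_zero_iff, card_eq_sum_rowLen h, Finset.range_zero, Finset.sum_empty]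

theorem rowLen_bot (i : ℕ) : (⊥ : YoungDiagram).rowLen i = 0 := by
  by_contra h
  exact notMem_bot (i, 0) (mem_iff_lt_rowLen.2 (Nat.pos_of_ne_zero h))

/-- The largest diagram inside `μ` whose `i`-th row has at most `f i` cells, for all `i`. -/
def cut (μ : YoungDiagram) (f : ℕ → ℕ) : YoungDiagram where
  cells := μ.cells.filter fun c => ∀ i ≤ c.1, c.2 < f i
  isLowerSet := by
    rintro ⟨i, j⟩ ⟨i', j'⟩ h hc
    have h1 : i' ≤ i := h.1
    have h2 : j' ≤ j := h.2
    simp only [Finset.coe_filter, mem_cells, Set.mem_ofPred_eq] at hc ⊢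
    exact ⟨μ.up_left_mem h1 h2 hc.1, fun a ha => h2.trans_lt (hc.2 a (ha.trans h1))⟩

theorem rowLen_cut {μ : YoungDiagram} {f : ℕ → ℕ} (hf : Antitone f) (hle : ∀ i, f i ≤ μ.rowLen i)
    (i : ℕ) : (μ.cut f).rowLen i = f i := by
  have key : ∀ j, j < (μ.cut f).rowLen i ↔ j < f i := by
    intro j
    rw [← mem_iff_lt_rowLen, ← mem_cells]
    simp only [cut, Finset.mem_filter, mem_cells, mem_iff_lt_rowLen]
    constructor
    · exact fun h => h.2 i le_rfl
    · exact fun h => ⟨h.trans_le (hle i), fun a ha => h.trans_le (hf ha)⟩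
  exact le_antisymm (not_lt.1 fun h => lt_irrefl _ ((key _).1 h))
    (not_lt.1 fun h => lt_irrefl _ ((key _).2 h))

theorem finite_setOf_le (μ : YoungDiagram) : {κ : YoungDiagram | κ ≤ μ}.Finite := by
  refine Set.Finite.of_finite_image (f := YoungDiagram.cells) ?_ ?_
  · refine (μ.cells.powerset.finite_toSet).subset ?_
    rintro _ ⟨κ, hκ, rfl⟩
    exact Finset.mem_coe.2 (Finset.mem_powerset.2 hκ)
  · exact fun κ _ ν _ h => YoungDiagram.ext h

/-- The diagrams `κ ⊆ μ` such that `μ / κ` is a horizontal strip, i.e. has at most one cell in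
each column. -/
noncomputable def strips (μ : YoungDiagram) : Finset YoungDiagram :=
  (μ.finite_setOf_le.subset (t := {κ | κ ≤ μ ∧ ∀ i, μ.rowLen (i + 1) ≤ κ.rowLen i})
    fun _ h => h.1).toFinset

theorem mem_strips {μ κ : YoungDiagram} :
    κ ∈ μ.strips ↔ κ ≤ μ ∧ ∀ i, μ.rowLen (i + 1) ≤ κ.rowLen i := by
  simp [strips]

theorem self_mem_strips (μ : YoungDiagram) : μ ∈ μ.strips :=
  mem_strips.2 ⟨le_rfl, fun i => μ.rowLen_anti i (i + 1) (Nat.le_succ i)⟩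

/-- The largest possible length of row `i` of a diagram `κ` such that `μ / κ` and `κ / ν` are
horizontal strips. -/
def stripUpper (μ ν : YoungDiagram) : ℕ → ℕ
  | 0 => μ.rowLen 0
  | i + 1 => min (μ.rowLen (i + 1)) (ν.rowLen i)

/-- The Bender–Knuth involution on the diagrams `κ` such that `μ / κ` and `κ / ν` are horizontal
strips: the length of each row of `κ` ranges over an interval, and is reflected in it. -/
def benderKnuth (μ ν κ : YoungDiagram) : YoungDiagram :=
  μ.cut fun i => max (ν.rowLen i) (μ.rowLen (i + 1)) + stripUpper μ ν i - κ.rowLen i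

/-- The lower and upper bounds of the rows of `κ` add up to the rows of `ν` and `μ`, since the lower
bound of row `i` and the upper bound of row `i + 1` are the maximum and the minimum of the same two
numbers. -/
theorem sum_max_add_stripUpper (μ ν : YoungDiagram) (n : ℕ) :
    ∑ i ∈ Finset.range n, (max (ν.rowLen i) (μ.rowLen (i + 1)) + stripUpper μ ν i) +
      stripUpper μ ν n = ∑ i ∈ Finset.range n, (ν.rowLen i + μ.rowLen i) + μ.rowLen n := by
  induction n with
  | zero => simp [stripUpper]
  | succ n ih =>
    have h : stripUpper μ ν (n + 1) = min (μ.rowLen (n + 1)) (ν.rowLen n) := rfl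
    rw [Finset.sum_range_succ, Finset.sum_range_succ, h]
    omega

section BenderKnuth

variable {μ κ ν : YoungDiagram}

/-- Together with `mem_strips_of_mem_Icc`: the diagrams between `ν` and `μ` that differ from both by
horizontal strips are given by independent choices of the row lengths in intervals. -/
theorem mem_Icc_of_mem_strips (h1 : κ ∈ μ.strips) (h2 : ν ∈ κ.strips) (i : ℕ) :
    max (ν.rowLen i) (μ.rowLen (i + 1)) ≤ κ.rowLen i ∧ κ.rowLen i ≤ stripUpper μ ν i := by
  rw [mem_strips, le_iff_rowLen_le] at h1 h2
  refine ⟨max_le (h2.1 i) (h1.2 i), ?_⟩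
  cases i with
  | zero => exact h1.1 0
  | succ i => exact le_min (h1.1 _) (h2.2 i)

theorem mem_strips_of_mem_Icc (h : ∀ i, max (ν.rowLen i) (μ.rowLen (i + 1)) ≤ κ.rowLen i ∧
    κ.rowLen i ≤ stripUpper μ ν i) : κ ∈ μ.strips ∧ ν ∈ κ.strips := by
  rw [mem_strips, mem_strips, le_iff_rowLen_le, le_iff_rowLen_le]
  refine ⟨⟨fun i => ?_, fun i => (le_max_right _ _).trans (h i).1⟩,
    ⟨fun i => (le_max_left _ _).trans (h i).1, fun i => (h (i + 1)).2.trans (min_le_right _ _)⟩⟩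
  cases i with
  | zero => exact (h 0).2
  | succ i => exact (h (i + 1)).2.trans (min_le_left _ _)

theorem rowLen_benderKnuth (h1 : κ ∈ μ.strips) (h2 : ν ∈ κ.strips) (i : ℕ) :
    (benderKnuth μ ν κ).rowLen i =
      max (ν.rowLen i) (μ.rowLen (i + 1)) + stripUpper μ ν i - κ.rowLen i := by
  have h := mem_Icc_of_mem_strips h1 h2
  refine rowLen_cut (antitone_nat_of_succ_le fun i => ?_) (fun i => ?_) i
  · have := h i
    have := h (i + 1)
    have : stripUpper μ ν (i + 1) ≤ max (ν.rowLen i) (μ.rowLen (i + 1)) :=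
      (min_le_left _ _).trans (le_max_right _ _)
    omega
  · have := h i
    have : stripUpper μ ν i ≤ μ.rowLen i := by
      cases i with
      | zero => exact le_rfl
      | succ i => exact min_le_left _ _
    omega

theorem benderKnuth_mem_strips (h1 : κ ∈ μ.strips) (h2 : ν ∈ κ.strips) :
    benderKnuth μ ν κ ∈ μ.strips ∧ ν ∈ (benderKnuth μ ν κ).strips := by
  refine mem_strips_of_mem_Icc fun i => ?_
  have := mem_Icc_of_mem_strips h1 h2 i
  rw [rowLen_benderKnuth h1 h2]
  omega

theorem benderKnuth_benderKnuth (h1 : κ ∈ μ.strips) (h2 : ν ∈ κ.strips) :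
    benderKnuth μ ν (benderKnuth μ ν κ) = κ := by
  obtain ⟨h3, h4⟩ := benderKnuth_mem_strips h1 h2
  refine ext_rowLen fun i => ?_
  have := mem_Icc_of_mem_strips h1 h2 i
  rw [rowLen_benderKnuth h3 h4, rowLen_benderKnuth h1 h2]
  omega

theorem card_benderKnuth (h1 : κ ∈ μ.strips) (h2 : ν ∈ κ.strips) :
    κ.card + (benderKnuth μ ν κ).card = μ.card + ν.card := by
  have hμ := μ.rowLen_colLen
  have hb := mem_Icc_of_mem_strips h1 h2
  obtain ⟨h3, h4⟩ := benderKnuth_mem_strips h1 h2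
  have hle1 := le_iff_rowLen_le.1 (mem_strips.1 h1).1 (μ.colLen 0)
  have hle2 := le_iff_rowLen_le.1 (mem_strips.1 h2).1 (μ.colLen 0)
  have hle3 := le_iff_rowLen_le.1 (mem_strips.1 h3).1 (μ.colLen 0)
  have hs := sum_max_add_stripUpper μ ν (μ.colLen 0)
  have hu : stripUpper μ ν (μ.colLen 0) = 0 := by
    generalize μ.colLen 0 = n at hμ
    cases n with
    | zero => exact hμ
    | succ n => exact Nat.le_zero.1 (hμ ▸ min_le_left _ _)
  rw [card_eq_sum_rowLen hμ, card_eq_sum_rowLen (n := μ.colLen 0) (μ := κ) (by omega),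
    card_eq_sum_rowLen (n := μ.colLen 0) (μ := ν) (by omega),
    card_eq_sum_rowLen (n := μ.colLen 0) (μ := benderKnuth μ ν κ) (by omega),
    ← Finset.sum_add_distrib, add_comm (∑ i ∈ _, μ.rowLen i), ← Finset.sum_add_distrib]
  rw [hμ, hu, add_zero, add_zero] at hs
  rw [← hs]
  refine Finset.sum_congr rfl fun i _ => ?_
  have := hb i
  rw [rowLen_benderKnuth h1 h2]
  omega

end BenderKnuth

/-- The diagram obtained by deleting the first row. -/
def tail (μ : YoungDiagram) : YoungDiagram := μ.cut fun i => μ.rowLen (i + 1)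

theorem rowLen_tail (μ : YoungDiagram) (i : ℕ) : μ.tail.rowLen i = μ.rowLen (i + 1) :=
  rowLen_cut (fun _ _ h => μ.rowLen_anti _ _ (Nat.succ_le_succ h))
    (fun i => μ.rowLen_anti i (i + 1) (Nat.le_succ i)) i

/-- The diagram obtained by putting a row of length `r` above `μ`, where `μ` is first truncated to
its `r` leftmost columns. -/
def consRow (r : ℕ) (μ : YoungDiagram) : YoungDiagram where
  cells := (Finset.range (μ.colLen 0 + 1) ×ˢ Finset.range r).filter
    fun c => c.1 = 0 ∨ (c.1 - 1, c.2) ∈ μ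
  isLowerSet := by
    rintro ⟨i, j⟩ ⟨i', j'⟩ h hc
    have h1 : i' ≤ i := h.1
    have h2 : j' ≤ j := h.2
    simp only [Finset.coe_filter, Finset.mem_product, Finset.mem_range, Set.mem_ofPred_eq] at hc ⊢
    refine ⟨⟨h1.trans_lt hc.1.1, h2.trans_lt hc.1.2⟩, ?_⟩
    rcases hc.2 with h0 | hmem
    · exact Or.inl (by omega)
    · exact Or.inr (μ.up_left_mem (by omega) h2 hmem)

theorem mem_consRow_zero {r : ℕ} {μ : YoungDiagram} {j : ℕ} : (0, j) ∈ consRow r μ ↔ j < r := by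
  rw [← mem_cells]
  simp [consRow]

theorem mem_consRow_succ {r : ℕ} {μ : YoungDiagram} {i j : ℕ} :
    (i + 1, j) ∈ consRow r μ ↔ j < r ∧ (i, j) ∈ μ := by
  rw [← mem_cells]
  simp only [consRow, Finset.mem_filter, Finset.mem_product, Finset.mem_range,
    Nat.succ_ne_zero, false_or, Nat.add_sub_cancel]
  constructor
  · exact fun h => ⟨h.1.2, h.2⟩
  · exact fun h => ⟨⟨Nat.succ_lt_succ
      (mem_iff_lt_colLen.1 (μ.up_left_mem le_rfl (Nat.zero_le _) h.2)), h.1⟩, h.2⟩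

theorem eq_of_forall_lt_iff {a b : ℕ} (h : ∀ j, j < a ↔ j < b) : a = b :=
  le_antisymm (not_lt.1 fun h' => lt_irrefl _ ((h _).1 h'))
    (not_lt.1 fun h' => lt_irrefl _ ((h _).2 h'))

theorem rowLen_consRow_zero (r : ℕ) (μ : YoungDiagram) : (consRow r μ).rowLen 0 = r :=
  eq_of_forall_lt_iff fun j => by rw [← mem_iff_lt_rowLen, mem_consRow_zero]

theorem rowLen_consRow_succ {r : ℕ} {μ : YoungDiagram} (h : μ.rowLen 0 ≤ r) (i : ℕ) :
    (consRow r μ).rowLen (i + 1) = μ.rowLen i :=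
  eq_of_forall_lt_iff fun j => by
    rw [← mem_iff_lt_rowLen, mem_consRow_succ, mem_iff_lt_rowLen]
    have := μ.rowLen_anti 0 i (Nat.zero_le i)
    omega

theorem tail_consRow {r : ℕ} {μ : YoungDiagram} (h : μ.rowLen 0 ≤ r) : (consRow r μ).tail = μ :=
  ext_rowLen fun i => by rw [rowLen_tail, rowLen_consRow_succ h]

theorem rowLen_tail_zero_le (μ : YoungDiagram) : μ.tail.rowLen 0 ≤ μ.rowLen 0 := by
  rw [rowLen_tail]
  exact μ.rowLen_anti 0 1 (Nat.zero_le _)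

theorem consRow_tail (μ : YoungDiagram) : consRow (μ.rowLen 0) μ.tail = μ := by
  refine ext_rowLen fun i => ?_
  cases i with
  | zero => exact rowLen_consRow_zero _ _
  | succ i => rw [rowLen_consRow_succ μ.rowLen_tail_zero_le, rowLen_tail]

theorem card_eq_rowLen_zero_add_card_tail (μ : YoungDiagram) :
    μ.card = μ.rowLen 0 + μ.tail.card := by
  have h : μ.rowLen (μ.colLen 0 + 1) = 0 := by
    have := μ.rowLen_anti (μ.colLen 0) (μ.colLen 0 + 1) (Nat.le_succ _)
    have := μ.rowLen_colLen
    omega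
  rw [card_eq_sum_rowLen h, card_eq_sum_rowLen (μ := μ.tail) (n := μ.colLen 0)
    ((μ.rowLen_tail _).trans h), Finset.sum_range_succ', add_comm]
  simp only [rowLen_tail]

theorem card_consRow {r : ℕ} {μ : YoungDiagram} (h : μ.rowLen 0 ≤ r) :
    (consRow r μ).card = r + μ.card := by
  rw [card_eq_rowLen_zero_add_card_tail, rowLen_consRow_zero, tail_consRow h]

theorem rowLen_zero_le_card (μ : YoungDiagram) : μ.rowLen 0 ≤ μ.card := by
  rw [card_eq_rowLen_zero_add_card_tail]
  exact Nat.le_add_right _ _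

theorem tail_mem_strips (μ : YoungDiagram) : μ.tail ∈ μ.strips := by
  rw [mem_strips, le_iff_rowLen_le]
  simp only [rowLen_tail, le_refl, implies_true, and_true]
  exact fun i => μ.rowLen_anti i (i + 1) (Nat.le_succ i)

theorem tail_le_of_mem_strips {μ κ : YoungDiagram} (h : κ ∈ μ.strips) : μ.tail ≤ κ := by
  rw [le_iff_rowLen_le]
  intro i
  rw [rowLen_tail]
  exact (mem_strips.1 h).2 i

end YoungDiagram

theorem plusDiagram_eq_consRow (μ : YoungDiagram) (n : ℕ) (h : 2 * μ.card ≤ n) :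
    plusDiagram μ n h = YoungDiagram.consRow (n - μ.card) μ := by
  have h1 := μ.rowLen_zero_le_card
  refine SetLike.ext fun ⟨i, j⟩ => ?_
  rw [plusDiagram, YoungDiagram.mem_ofRowLens]
  cases i with
  | zero => simp [YoungDiagram.mem_consRow_zero]
  | succ i =>
    rw [YoungDiagram.mem_consRow_succ, YoungDiagram.mem_iff_lt_rowLen]
    have h2 := μ.rowLen_anti 0 i (Nat.zero_le _)
    simp only [List.length_cons, Nat.add_lt_add_iff_right,
      List.getElem_cons_succ, YoungDiagram.get_rowLens, YoungDiagram.length_rowLens]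
    constructor
    · rintro ⟨_, h3⟩
      omega
    · rintro ⟨_, h3⟩
      refine ⟨?_, h3⟩
      exact YoungDiagram.mem_iff_lt_colLen.1
        (μ.up_left_mem le_rfl (Nat.zero_le _) (YoungDiagram.mem_iff_lt_rowLen.2 h3))

/-! ### Schur functions as functions on multisets -/

section SchurEval

variable {R S : Type*} [CommSemiring R] [CommSemiring S]

/-- The value of the Schur function `s_μ` at the list of variables `l`, computed by the branching
rule, which removes one variable and a horizontal strip at a time. -/
noncomputable def schurList : List R → YoungDiagram → R
  | [], μ => if μ.card = 0 then 1 else 0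
  | t :: l, μ => ∑ κ ∈ μ.strips, t ^ (μ.card - κ.card) * schurList l κ

/-- The Bender–Knuth symmetry: two adjacent variables may be exchanged. -/
theorem schurList_swap (t u : R) (l : List R) (μ : YoungDiagram) :
    schurList (t :: u :: l) μ = schurList (u :: t :: l) μ := by
  simp only [schurList, Finset.mul_sum]
  rw [Finset.sum_sigma', Finset.sum_sigma']
  refine Finset.sum_bij' (fun p _ => ⟨YoungDiagram.benderKnuth μ p.2 p.1, p.2⟩)
    (fun p _ => ⟨YoungDiagram.benderKnuth μ p.2 p.1, p.2⟩) ?_ ?_ ?_ ?_ ?_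
  · rintro ⟨κ, ν⟩ h
    rw [Finset.mem_sigma] at h ⊢
    exact YoungDiagram.benderKnuth_mem_strips h.1 h.2
  · rintro ⟨κ, ν⟩ h
    rw [Finset.mem_sigma] at h ⊢
    exact YoungDiagram.benderKnuth_mem_strips h.1 h.2
  · rintro ⟨κ, ν⟩ h
    rw [Finset.mem_sigma] at h
    simp only [YoungDiagram.benderKnuth_benderKnuth h.1 h.2]
  · rintro ⟨κ, ν⟩ h
    rw [Finset.mem_sigma] at h
    simp only [YoungDiagram.benderKnuth_benderKnuth h.1 h.2]
  · rintro ⟨κ, ν⟩ h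
    rw [Finset.mem_sigma] at h
    have h1 := YoungDiagram.card_mono (YoungDiagram.mem_strips.1 h.1).1
    have h2 := YoungDiagram.card_mono (YoungDiagram.mem_strips.1 h.2).1
    have h3 := YoungDiagram.card_benderKnuth h.1 h.2
    have e1 : μ.card - (YoungDiagram.benderKnuth μ ν κ).card = κ.card - ν.card := by
      simp only at h1 h2 h3
      omega
    have e2 : (YoungDiagram.benderKnuth μ ν κ).card - ν.card = μ.card - κ.card := by
      simp only at h1 h2 h3
      omega
    simp only [e1, e2]
    ring

theorem schurList_perm {l l' : List R} (h : l.Perm l') : schurList l = schurList l' := by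
  induction h with
  | nil => rfl
  | cons t _ ih =>
    funext μ
    simp only [schurList, ih]
  | swap t u l =>
    funext μ
    exact schurList_swap u t l μ
  | trans _ _ ih1 ih2 => exact ih1.trans ih2

/-- The value of the Schur function `s_μ` at a multiset of variables. -/
noncomputable def schurEval (μ : YoungDiagram) (s : Multiset R) : R :=
  Quot.liftOn s (fun l => schurList l μ) fun _ _ h => congrFun (schurList_perm h) μ

theorem schurEval_zero (μ : YoungDiagram) :
    schurEval μ (0 : Multiset R) = if μ.card = 0 then 1 else 0 := rfl

theorem schurEval_cons (μ : YoungDiagram) (t : R) (s : Multiset R) :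
    schurEval μ (t ::ₘ s) = ∑ κ ∈ μ.strips, t ^ (μ.card - κ.card) * schurEval κ s := by
  induction s using Quotient.inductionOn
  rfl

theorem map_schurEval {F : Type*} [FunLike F R S] [RingHomClass F R S] (φ : F) (μ : YoungDiagram)
    (s : Multiset R) : φ (schurEval μ s) = schurEval μ (s.map φ) := by
  induction s using Multiset.induction_on generalizing μ with
  | empty =>
    rw [Multiset.map_zero, schurEval_zero, schurEval_zero]
    split_ifs <;> simp
  | cons t s ih =>
    rw [Multiset.map_cons, schurEval_cons, schurEval_cons, map_sum]
    exact Finset.sum_congr rfl fun κ _ => by rw [map_mul, map_pow, ih]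

theorem card_sub_eq_zero_iff {μ κ : YoungDiagram} (h : κ ∈ μ.strips) :
    μ.card - κ.card = 0 ↔ κ = μ := by
  constructor
  · intro h0
    exact YoungDiagram.eq_of_le_of_card_le (YoungDiagram.mem_strips.1 h).1
      (Nat.sub_eq_zero_iff_le.1 h0)
  · rintro rfl
    exact Nat.sub_self _

theorem schurEval_zero_cons (μ : YoungDiagram) (s : Multiset R) :
    schurEval μ (0 ::ₘ s) = schurEval μ s := by
  rw [schurEval_cons, Finset.sum_eq_single_of_mem μ μ.self_mem_strips]
  · simp
  · intro κ hκ hne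
    rw [zero_pow (fun h => hne ((card_sub_eq_zero_iff hκ).1 h)), zero_mul]

/-- The Schur function `s_μ` is homogeneous of degree `|μ|`. -/
theorem schurEval_map_mul (μ : YoungDiagram) (c : R) (s : Multiset R) :
    schurEval μ (s.map (c * ·)) = c ^ μ.card * schurEval μ s := by
  induction s using Multiset.induction_on generalizing μ with
  | empty =>
    rw [Multiset.map_zero, schurEval_zero]
    split_ifs with h <;> simp [h]
  | cons t s ih =>
    rw [Multiset.map_cons, schurEval_cons, schurEval_cons, Finset.mul_sum]
    refine Finset.sum_congr rfl fun κ hκ => ?_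
    have h1 := YoungDiagram.card_mono (YoungDiagram.mem_strips.1 hκ).1
    rw [ih, mul_pow, ← Nat.sub_add_cancel h1, pow_add, Nat.add_sub_cancel]
    ring

theorem schurEval_bot (s : Multiset R) : schurEval ⊥ s = 1 := by
  induction s using Multiset.induction_on with
  | empty => rfl
  | cons t s ih =>
    rw [schurEval_cons, Finset.sum_eq_single_of_mem ⊥ (YoungDiagram.self_mem_strips _), ih]
    · simp
    · intro κ hκ hne
      exact absurd (le_bot_iff.1 (YoungDiagram.mem_strips.1 hκ).1) hne

end SchurEval

/-! ### Schur polynomials as generating functions of tableaux -/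

section Tableaux

variable {μ κ : YoungDiagram}

/-- The cells of a tableau whose entries are less than `n`. -/
def SemistandardYoungTableau.lowerShape (T : SemistandardYoungTableau μ) (n : ℕ) :
    YoungDiagram where
  cells := μ.cells.filter fun c => T c.1 c.2 < n
  isLowerSet := by
    rintro ⟨i, j⟩ ⟨i', j'⟩ h hc
    have h1 : i' ≤ i := h.1
    have h2 : j' ≤ j := h.2
    simp only [Finset.coe_filter, YoungDiagram.mem_cells, Set.mem_ofPred_eq] at hc ⊢
    refine ⟨μ.up_left_mem h1 h2 hc.1, ?_⟩
    exact ((T.row_weak_of_le h2 (μ.up_left_mem h1 le_rfl hc.1)).trans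
      (T.col_weak h1 hc.1)).trans_lt hc.2

theorem SemistandardYoungTableau.mem_lowerShape {T : SemistandardYoungTableau μ} {n i j : ℕ} :
    (i, j) ∈ T.lowerShape n ↔ (i, j) ∈ μ ∧ T i j < n := by
  rw [← YoungDiagram.mem_cells]
  simp [lowerShape]

theorem SemistandardYoungTableau.lowerShape_mem_strips (T : SemistandardYoungTableau μ) (n : ℕ)
    (hT : ∀ c ∈ μ.cells, T c.1 c.2 < n + 1) : T.lowerShape n ∈ μ.strips := by
  rw [YoungDiagram.mem_strips]
  refine ⟨fun c hc => (mem_lowerShape.1 hc).1, fun i => ?_⟩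
  by_contra! hlt
  have h1 : (i + 1, (T.lowerShape n).rowLen i) ∈ μ := YoungDiagram.mem_iff_lt_rowLen.2 hlt
  have h2 := T.col_strict (show i < i + 1 from Nat.lt_succ_self i) h1
  have h3 := hT _ ((YoungDiagram.mem_cells _).2 h1)
  have h4 : (i, (T.lowerShape n).rowLen i) ∈ T.lowerShape n :=
    mem_lowerShape.2 ⟨μ.up_left_mem (Nat.le_succ i) le_rfl h1, by simp only at h3; omega⟩
  exact lt_irrefl _ (YoungDiagram.mem_iff_lt_rowLen.1 h4)

/-- The restriction of a tableau to the cells with entries less than `n`. -/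
def BoundedSSYT.lower {n : ℕ} (T : BoundedSSYT μ (n + 1)) :
    BoundedSSYT (T.1.lowerShape n) n :=
  ⟨{ entry := fun i j => if (i, j) ∈ T.1.lowerShape n then T.1 i j else 0
     row_weak' := fun {i j1 j2} hj hc => by
       rw [if_pos hc, if_pos (YoungDiagram.up_left_mem _ le_rfl hj.le hc)]
       exact T.1.row_weak hj (SemistandardYoungTableau.mem_lowerShape.1 hc).1
     col_strict' := fun {i1 i2 j} hi hc => by
       rw [if_pos hc, if_pos (YoungDiagram.up_left_mem _ hi.le le_rfl hc)]
       exact T.1.col_strict hi (SemistandardYoungTableau.mem_lowerShape.1 hc).1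
     zeros' := fun hc => if_neg hc }, by
    rintro ⟨i, j⟩ hc
    rw [YoungDiagram.mem_cells] at hc
    change (if (i, j) ∈ T.1.lowerShape n then T.1 i j else 0) < n
    rw [if_pos hc]
    exact (SemistandardYoungTableau.mem_lowerShape.1 hc).2⟩

theorem BoundedSSYT.lower_apply {n : ℕ} (T : BoundedSSYT μ (n + 1)) (i j : ℕ) :
    T.lower.1 i j = if (i, j) ∈ T.1.lowerShape n then T.1 i j else 0 := rfl

/-- The tableau obtained from a tableau of shape `κ` by filling the horizontal strip `μ / κ`
with `n`. -/
def BoundedSSYT.extend {n : ℕ} (T : BoundedSSYT κ n) (h : κ ∈ μ.strips) :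
    BoundedSSYT μ (n + 1) :=
  ⟨{ entry := fun i j => if (i, j) ∈ κ then T.1 i j else if (i, j) ∈ μ then n else 0
     row_weak' := fun {i j1 j2} hj hc => by
       have h1 : (i, j1) ∈ μ := μ.up_left_mem le_rfl hj.le hc
       by_cases h2 : (i, j2) ∈ κ
       · rw [if_pos h2, if_pos (κ.up_left_mem le_rfl hj.le h2)]
         exact T.1.row_weak hj h2
       · rw [if_neg h2, if_pos hc]
         split_ifs with h3
         · exact (T.2 _ ((YoungDiagram.mem_cells _).2 h3)).le
         · exact le_rfl
     col_strict' := fun {i1 i2 j} hi hc => by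
       have h1 : (i1, j) ∈ κ := by
         rw [YoungDiagram.mem_iff_lt_rowLen] at hc ⊢
         exact (hc.trans_le (μ.rowLen_anti _ _ hi)).trans_le ((YoungDiagram.mem_strips.1 h).2 i1)
       rw [if_pos h1]
       by_cases h2 : (i2, j) ∈ κ
       · rw [if_pos h2]
         exact T.1.col_strict hi h2
       · rw [if_neg h2, if_pos hc]
         exact T.2 _ ((YoungDiagram.mem_cells _).2 h1)
     zeros' := fun {i j} hc => by
       rw [if_neg fun h2 => hc ((YoungDiagram.mem_strips.1 h).1 h2), if_neg hc] }, by
    rintro ⟨i, j⟩ hc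
    rw [YoungDiagram.mem_cells] at hc
    change (if (i, j) ∈ κ then T.1 i j else if (i, j) ∈ μ then n else 0) < n + 1
    split_ifs with h2
    · exact Nat.lt_succ_of_lt (T.2 _ ((YoungDiagram.mem_cells _).2 h2))
    · exact Nat.lt_succ_self n⟩

theorem BoundedSSYT.extend_apply {n : ℕ} (T : BoundedSSYT κ n) (h : κ ∈ μ.strips) (i j : ℕ) :
    (T.extend h).1 i j = if (i, j) ∈ κ then T.1 i j else if (i, j) ∈ μ then n else 0 := rfl

theorem BoundedSSYT.lowerShape_extend {n : ℕ} (T : BoundedSSYT κ n) (h : κ ∈ μ.strips) :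
    (T.extend h).1.lowerShape n = κ := by
  refine SetLike.ext fun ⟨i, j⟩ => ?_
  rw [SemistandardYoungTableau.mem_lowerShape, extend_apply]
  constructor
  · rintro ⟨h1, h2⟩
    by_contra h3
    rw [if_neg h3, if_pos h1] at h2
    exact lt_irrefl _ h2
  · intro h1
    rw [if_pos h1]
    exact ⟨(YoungDiagram.mem_strips.1 h).1 h1, T.2 _ ((YoungDiagram.mem_cells _).2 h1)⟩

theorem BoundedSSYT.sigma_ext {n : ℕ} {p q : Σ κ : YoungDiagram, BoundedSSYT κ n}
    (h : p.1 = q.1) (h' : ∀ i j, p.2.1 i j = q.2.1 i j) : p = q := by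
  obtain ⟨κ, T⟩ := p
  obtain ⟨κ', T'⟩ := q
  obtain rfl : κ = κ' := h
  congr 1
  exact Subtype.ext (SemistandardYoungTableau.ext h')

variable {R : Type*} [CommSemiring R]

/-- The generating function of the tableaux of shape `μ` with entries less than `n`, where the
entry `i` has weight `a i`. -/
noncomputable def ssytSum (a : ℕ → R) (n : ℕ) (μ : YoungDiagram) : R :=
  ∑ T : BoundedSSYT μ n, ∏ c ∈ μ.cells, a (T.1 c.1 c.2)

/-- The branching rule: a tableau is cut into the part with entries less than `n` and the
horizontal strip of the entries equal to `n`. -/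
theorem ssytSum_succ (a : ℕ → R) (n : ℕ) (μ : YoungDiagram) :
    ssytSum a (n + 1) μ = ∑ κ ∈ μ.strips, a n ^ (μ.card - κ.card) * ssytSum a n κ := by
  simp only [ssytSum, Finset.mul_sum]
  rw [Finset.sum_sigma']
  refine Finset.sum_bij' (fun T _ => ⟨T.1.lowerShape n, BoundedSSYT.lower T⟩)
    (fun p hp => BoundedSSYT.extend p.2 (Finset.mem_sigma.1 hp).1) ?_ ?_ ?_ ?_ ?_
  · intro T _
    exact Finset.mem_sigma.2 ⟨T.1.lowerShape_mem_strips n T.2, Finset.mem_univ _⟩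
  · intro p _
    exact Finset.mem_univ _
  · intro T _
    refine Subtype.ext (SemistandardYoungTableau.ext fun i j => ?_)
    rw [BoundedSSYT.extend_apply, BoundedSSYT.lower_apply]
    split_ifs with h1 h2
    · rfl
    · have h3 : ¬ T.1 i j < n := fun h => h1 (SemistandardYoungTableau.mem_lowerShape.2 ⟨h2, h⟩)
      have h4 := T.2 _ ((YoungDiagram.mem_cells _).2 h2)
      simp only at h4
      omega
    · exact (T.1.zeros h2).symm
  · intro p hp
    refine BoundedSSYT.sigma_ext (BoundedSSYT.lowerShape_extend _ (Finset.mem_sigma.1 hp).1)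
      fun i j => ?_
    rw [BoundedSSYT.lower_apply, BoundedSSYT.lowerShape_extend, BoundedSSYT.extend_apply]
    split_ifs with h1
    · rfl
    · exact (p.2.1.zeros h1).symm
  · intro T _
    have hsub : (T.1.lowerShape n).cells ⊆ μ.cells := Finset.filter_subset _ _
    rw [← Finset.prod_sdiff hsub]
    congr 1
    · rw [Finset.prod_congr rfl (g := fun _ => a n), Finset.prod_const,
        Finset.card_sdiff_of_subset hsub]
      · rintro ⟨i, j⟩ hc
        rw [Finset.mem_sdiff, YoungDiagram.mem_cells, YoungDiagram.mem_cells,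
          SemistandardYoungTableau.mem_lowerShape] at hc
        have h4 := T.2 _ ((YoungDiagram.mem_cells _).2 hc.1)
        have h5 : T.1 i j = n := by
          have h6 : ¬ T.1 i j < n := fun h => hc.2 ⟨hc.1, h⟩
          simp only at h4
          omega
        simp only [h5]
    · refine Finset.prod_congr rfl ?_
      rintro ⟨i, j⟩ hc
      rw [YoungDiagram.mem_cells] at hc
      rw [BoundedSSYT.lower_apply, if_pos hc]

theorem ssytSum_zero (a : ℕ → R) (μ : YoungDiagram) :
    ssytSum a 0 μ = if μ.card = 0 then 1 else 0 := by
  split_ifs with h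
  · obtain rfl := YoungDiagram.card_eq_zero_iff.1 h
    let T : BoundedSSYT ⊥ 0 :=
      ⟨SemistandardYoungTableau.highestWeight ⊥, fun c hc => absurd hc (Finset.notMem_empty c)⟩
    have hT : ∀ T' : BoundedSSYT ⊥ 0, T' = T := fun T' =>
      Subtype.ext (SemistandardYoungTableau.ext fun i j => by
        rw [T'.1.zeros (YoungDiagram.notMem_bot _), T.1.zeros (YoungDiagram.notMem_bot _)])
    rw [ssytSum, Finset.sum_eq_single T (fun T' _ hne => absurd (hT T') hne)
      (fun hn => absurd (Finset.mem_univ _) hn)]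
    simp
  · have hne : μ.cells.Nonempty := Finset.card_pos.1 (Nat.pos_of_ne_zero h)
    obtain ⟨c, hc⟩ := hne
    exact Finset.sum_eq_zero fun T _ => absurd (T.2 c hc) (Nat.not_lt_zero _)

theorem ssytSum_eq_schurEval (a : ℕ → R) (n : ℕ) (μ : YoungDiagram) :
    ssytSum a n μ = schurEval μ ((Multiset.range n).map a) := by
  induction n generalizing μ with
  | zero => rw [ssytSum_zero, Multiset.range_zero, Multiset.map_zero, schurEval_zero]
  | succ n ih =>
    rw [ssytSum_succ, Multiset.range_succ, Multiset.map_cons, schurEval_cons]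
    exact Finset.sum_congr rfl fun κ _ => by rw [ih]

theorem aeval_schurPoly {A : Type*} [CommRing A] [Algebra ℤ A] (μ : YoungDiagram) {n : ℕ}
    (g : Fin n → A) :
    MvPolynomial.aeval g (schurPoly μ n) =
      schurEval μ ((Finset.univ : Finset (Fin n)).val.map g) := by
  let a : ℕ → A := fun i => if h : i < n then g ⟨i, h⟩ else 0
  have h1 : MvPolynomial.aeval g (schurPoly μ n) = ssytSum a n μ := by
    rw [schurPoly, map_sum, ssytSum]
    refine Finset.sum_congr rfl fun T _ => ?_
    rw [map_prod, ← Finset.prod_coe_sort μ.cells]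
    refine Finset.prod_congr rfl fun c _ => ?_
    rw [MvPolynomial.aeval_X]
    simp only [a]
    rw [dif_pos (T.2 c.1 c.2)]
  have h2 : (Multiset.range n).map a = (Finset.univ : Finset (Fin n)).val.map g := by
    have h3 : Multiset.range n = (Finset.univ : Finset (Fin n)).val.map Fin.val := by
      rw [← Finset.range_val, ← Nat.Iio_eq_range,
        ← Fin.map_valEmbedding_univ]
      rfl
    rw [h3, Multiset.map_map]
    exact Multiset.map_congr rfl fun i _ => dif_pos i.2
  rw [h1, ssytSum_eq_schurEval, h2]

end Tableaux

/-! ### Coefficients in one variable -/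

section Coefficients

open Polynomial

variable {R : Type*} [CommRing R]

theorem coeff_schurEval_X_cons (μ : YoungDiagram) (s : Multiset R) (n : ℕ) :
    (schurEval μ (X ::ₘ s.map C)).coeff n =
      ∑ κ ∈ μ.strips, if n = μ.card - κ.card then schurEval κ s else 0 := by
  rw [schurEval_cons, finsetSum_coeff]
  refine Finset.sum_congr rfl fun κ _ => ?_
  rw [← map_schurEval, mul_comm, coeff_C_mul, coeff_X_pow]
  split_ifs <;> simp

theorem coeff_schurEval_of_lt {μ : YoungDiagram} {n : ℕ} (h : μ.rowLen 0 < n) (s : Multiset R) :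
    (schurEval μ (X ::ₘ s.map C)).coeff n = 0 := by
  rw [coeff_schurEval_X_cons]
  refine Finset.sum_eq_zero fun κ hκ => if_neg ?_
  have h1 := YoungDiagram.card_mono (YoungDiagram.tail_le_of_mem_strips hκ)
  have h2 := μ.card_eq_rowLen_zero_add_card_tail
  omega

/-- The top coefficient of `s_μ` in one variable is the Schur function of `μ` without its first
row. -/
theorem coeff_schurEval_rowLen_zero (μ : YoungDiagram) (s : Multiset R) :
    (schurEval μ (X ::ₘ s.map C)).coeff (μ.rowLen 0) = schurEval μ.tail s := by
  have h2 := μ.card_eq_rowLen_zero_add_card_tail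
  rw [coeff_schurEval_X_cons, Finset.sum_eq_single_of_mem _ μ.tail_mem_strips, if_pos (by omega)]
  intro κ hκ hne
  have hle := YoungDiagram.tail_le_of_mem_strips hκ
  refine if_neg fun h => hne (YoungDiagram.eq_of_le_of_card_le hle ?_).symm
  have h3 := YoungDiagram.card_mono (YoungDiagram.mem_strips.1 hκ).1
  omega

/-- If some of the variables of `s_μ` are multiplied by `X`, the result has degree at most `|μ|` in
`X`. -/
theorem natDegree_schurEval_add_le (μ : YoungDiagram) (s u : Multiset R) :
    (schurEval μ (s.map C + (u.map C).map (X * ·))).natDegree ≤ μ.card := by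
  induction s using Multiset.induction_on generalizing μ with
  | empty =>
    rw [Multiset.map_zero, zero_add, schurEval_map_mul, ← map_schurEval, mul_comm]
    exact natDegree_C_mul_X_pow_le _ _
  | cons t s ih =>
    rw [Multiset.map_cons, Multiset.cons_add, schurEval_cons]
    refine natDegree_sum_le_of_forall_le _ _ fun κ hκ => ?_
    rw [← C_pow]
    exact (natDegree_C_mul_le _ _).trans
      ((ih κ).trans (YoungDiagram.card_mono (YoungDiagram.mem_strips.1 hκ).1))

/-- If some of the variables of `s_μ` are multiplied by `X`, the coefficient of `X ^ |μ|` is `s_μ`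
in these variables. -/
theorem coeff_schurEval_add (μ : YoungDiagram) (s u : Multiset R) :
    (schurEval μ (s.map C + (u.map C).map (X * ·))).coeff μ.card = schurEval μ u := by
  induction s using Multiset.induction_on with
  | empty =>
    rw [Multiset.map_zero, zero_add, schurEval_map_mul, ← map_schurEval, mul_comm, coeff_C_mul,
      coeff_X_pow, if_pos rfl, mul_one]
  | cons t s ih =>
    rw [Multiset.map_cons, Multiset.cons_add, schurEval_cons, finsetSum_coeff,
      Finset.sum_eq_single_of_mem μ μ.self_mem_strips]
    · rw [Nat.sub_self, pow_zero, one_mul, ih]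
    · intro κ hκ hne
      rw [← C_pow, coeff_C_mul, coeff_eq_zero_of_natDegree_lt, mul_zero]
      refine (natDegree_schurEval_add_le κ s u).trans_lt ?_
      have h1 := (YoungDiagram.mem_strips.1 hκ).1
      exact lt_of_not_ge fun h => hne (YoungDiagram.eq_of_le_of_card_le h1 h)

end Coefficients

/-! ### Linear independence of the Schur functions -/

section LinearIndependence

open Polynomial

/-- The Schur functions are linearly independent. In a vanishing combination, the top coefficient
in one variable is a vanishing combination of Schur functions of smaller degree. -/
theorem eq_zero_of_sum_smul_schurEval_eq_zero (m : ℕ) (A : Finset YoungDiagram)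
    (c : YoungDiagram → ℤ) (hA : ∀ π ∈ A, π.card ≤ m)
    (h : ∀ (R : Type) [CommRing R] (s : Multiset R), ∑ π ∈ A, c π • schurEval π s = 0) :
    ∀ π ∈ A, c π = 0 := by
  classical
  induction m using Nat.strong_induction_on generalizing A c with
  | _ m ih =>
  let A' := A.filter fun π => c π ≠ 0
  have h' : ∀ (R : Type) [CommRing R] (s : Multiset R), ∑ π ∈ A', c π • schurEval π s = 0 := by
    intro R _ s
    rw [← h R s]
    refine Finset.sum_subset (Finset.filter_subset _ _) fun π h1 h2 => ?_
    have : c π = 0 := by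
      by_contra h3
      exact h2 (Finset.mem_filter.2 ⟨h1, h3⟩)
    rw [this, zero_smul]
  by_contra! hne
  obtain ⟨π₁, hπ₁, hc₁⟩ := hne
  obtain ⟨π₀, hπ₀, hmax⟩ := Finset.exists_max_image A' (fun π => π.rowLen 0)
    ⟨π₁, Finset.mem_filter.2 ⟨hπ₁, hc₁⟩⟩
  have hc₀ : c π₀ ≠ 0 := (Finset.mem_filter.1 hπ₀).2
  have hm₀ := hA π₀ (Finset.mem_filter.1 hπ₀).1
  rcases Nat.eq_zero_or_pos (π₀.rowLen 0) with hr | hr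
  · have hbot : ∀ π ∈ A', π = ⊥ := fun π hπ =>
      YoungDiagram.eq_bot_of_rowLen_zero (Nat.le_zero.1 ((hmax π hπ).trans_eq hr))
    have h1 := h' ℤ 0
    rw [Finset.sum_eq_single_of_mem π₀ hπ₀ fun π hπ hn =>
      absurd ((hbot π hπ).trans (hbot π₀ hπ₀).symm) hn, hbot π₀ hπ₀, schurEval_bot] at h1
    rw [hbot π₀ hπ₀] at hc₀
    exact hc₀ (by simpa using h1)
  · set r := π₀.rowLen 0 with hr_def
    have hinj : ∀ π ∈ A'.filter (fun π => π.rowLen 0 = r), YoungDiagram.consRow r π.tail = π := by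
      intro π hπ
      rw [← (Finset.mem_filter.1 hπ).2]
      exact YoungDiagram.consRow_tail π
    have hm : m - r < m := by
      have := π₀.rowLen_zero_le_card
      omega
    have key := ih (m - r) hm ((A'.filter fun π => π.rowLen 0 = r).image YoungDiagram.tail)
      (fun ν => c (YoungDiagram.consRow r ν)) ?_ ?_ π₀.tail
      (Finset.mem_image_of_mem _ (Finset.mem_filter.2 ⟨hπ₀, rfl⟩))
    · rw [hinj π₀ (Finset.mem_filter.2 ⟨hπ₀, rfl⟩)] at key
      exact hc₀ key
    · intro ν hν
      obtain ⟨π, hπ, rfl⟩ := Finset.mem_image.1 hν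
      have h1 := (Finset.mem_filter.1 hπ).2
      have h2 := hA π (Finset.mem_filter.1 (Finset.mem_filter.1 hπ).1).1
      have h3 := π.card_eq_rowLen_zero_add_card_tail
      omega
    · intro R _ s
      rw [Finset.sum_image fun π hπ π' hπ' he => by rw [← hinj π hπ, ← hinj π' hπ', he]]
      have h1 := congrArg (fun p => Polynomial.coeff p r) (h' R[X] (X ::ₘ s.map C))
      simp only [finsetSum_coeff, coeff_smul, coeff_zero] at h1
      rw [Finset.sum_filter]
      refine (Finset.sum_congr rfl fun π hπ => ?_).trans h1
      split_ifs with h2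
      · rw [hinj π (Finset.mem_filter.2 ⟨hπ, h2⟩), ← h2, coeff_schurEval_rowLen_zero]
      · rw [coeff_schurEval_of_lt (lt_of_le_of_ne (hmax π hπ) h2), smul_zero]

end LinearIndependence

/-! ### Symmetric functions as natural functions on multisets -/

section SymFun

open Polynomial

/-- A symmetric function, as a rule that evaluates it at every finite multiset of elements of a
commutative ring, naturally in the ring and so that zero variables may be dropped. -/
structure SymFun where
  /-- The value at a multiset of variables. -/
  eval : ∀ {R : Type} [CommRing R], Multiset R → R
  map_eval : ∀ {R S : Type} [CommRing R] [CommRing S] (φ : R →+* S) (s : Multiset R),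
    φ (eval s) = eval (s.map φ)
  eval_zero_cons : ∀ {R : Type} [CommRing R] (s : Multiset R), eval (0 ::ₘ s) = eval s

namespace SymFun

/-- The symmetric function `F` is homogeneous of degree `d`. -/
def IsHomogeneous (F : SymFun) (d : ℕ) : Prop :=
  ∀ {R : Type} [CommRing R] (c : R) (s : Multiset R), F.eval (s.map (c * ·)) = c ^ d * F.eval s

/-- The symmetric function `F` has degree at most `r` in each variable. -/
def DegreeLE (F : SymFun) (r : ℕ) : Prop :=
  ∀ {R : Type} [CommRing R] (s : Multiset R) (n : ℕ), r < n →
    (F.eval (X ::ₘ s.map C)).coeff n = 0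

/-- The coefficient of the `r`-th power of one variable, as a symmetric function of the others. -/
noncomputable def varCoeff (F : SymFun) (r : ℕ) : SymFun where
  eval s := (F.eval (X ::ₘ s.map C)).coeff r
  map_eval φ s := by
    rw [← coeff_map, ← coe_mapRingHom, F.map_eval, Multiset.map_cons, Multiset.map_map,
      Multiset.map_map, coe_mapRingHom, map_X]
    congr 4
    funext a
    simp
  eval_zero_cons s := by
    rw [Multiset.map_cons, Multiset.cons_swap, C_0, F.eval_zero_cons]

theorem varCoeff_eval (F : SymFun) (r : ℕ) {R : Type} [CommRing R] (s : Multiset R) :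
    (F.varCoeff r).eval s = (F.eval (X ::ₘ s.map C)).coeff r := rfl

/-- The symmetric function `∑ c_π s_π`. -/
noncomputable def ofCoeffs (c : YoungDiagram →₀ ℤ) : SymFun where
  eval s := c.sum fun π a => a • schurEval π s
  map_eval φ s := by
    simp only [Finsupp.sum, map_sum, map_zsmul, map_schurEval]
  eval_zero_cons s := by
    simp only [schurEval_zero_cons]

theorem ofCoeffs_eval (c : YoungDiagram →₀ ℤ) {R : Type} [CommRing R] (s : Multiset R) :
    (ofCoeffs c).eval s = c.sum fun π a => a • schurEval π s := rfl

theorem coeff_ofCoeffs (c : YoungDiagram →₀ ℤ) {R : Type} [CommRing R] (s : Multiset R) (n : ℕ) :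
    ((ofCoeffs c).eval (X ::ₘ s.map C)).coeff n =
      c.sum fun π a => a • (schurEval π (X ::ₘ s.map C)).coeff n := by
  rw [ofCoeffs_eval, Finsupp.sum, finsetSum_coeff]
  exact Finset.sum_congr rfl fun π _ => coeff_smul _ _ _

theorem ofCoeffs_isHomogeneous {c : YoungDiagram →₀ ℤ} {d : ℕ}
    (h : ∀ π ∈ c.support, π.card = d) : (ofCoeffs c).IsHomogeneous d := by
  intro R _ t s
  rw [ofCoeffs_eval, ofCoeffs_eval, Finsupp.sum, Finsupp.sum, Finset.mul_sum]
  refine Finset.sum_congr rfl fun π hπ => ?_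
  rw [schurEval_map_mul, h π hπ, mul_smul_comm]

/-- The difference of two symmetric functions. -/
noncomputable def sub (F G : SymFun) : SymFun where
  eval s := F.eval s - G.eval s
  map_eval φ s := by rw [map_sub, F.map_eval, G.map_eval]
  eval_zero_cons s := by rw [F.eval_zero_cons, G.eval_zero_cons]

theorem sub_eval (F G : SymFun) {R : Type} [CommRing R] (s : Multiset R) :
    (F.sub G).eval s = F.eval s - G.eval s := rfl

theorem IsHomogeneous.sub {F G : SymFun} {d : ℕ} (hF : F.IsHomogeneous d)
    (hG : G.IsHomogeneous d) : (F.sub G).IsHomogeneous d := by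
  intro R _ c s
  rw [sub_eval, sub_eval, hF, hG, mul_sub]

/-- Exchanging two of the variables shows that the coefficients keep the degree bound. -/
theorem DegreeLE.varCoeff {F : SymFun} {r : ℕ} (h : F.DegreeLE r) (m : ℕ) :
    (F.varCoeff m).DegreeLE r := by
  intro R _ s n hn
  rw [varCoeff_eval, Multiset.map_cons, Multiset.map_map]
  have hswap : Polynomial.Bivariate.swap
      (F.eval (X ::ₘ (C X : R[X][X]) ::ₘ s.map (C ∘ C))) =
      F.eval (X ::ₘ (C X : R[X][X]) ::ₘ s.map (C ∘ C)) := by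
    have := F.map_eval (Polynomial.Bivariate.swap (R := R) : R[X][X] ≃ₐ[R] R[X][X]).toRingHom
      (X ::ₘ (C X : R[X][X]) ::ₘ s.map (C ∘ C))
    refine this.trans ?_
    rw [Multiset.map_cons, Multiset.map_cons, Multiset.map_map, Multiset.cons_swap]
    congr 1
    congr 1
    · exact Polynomial.Bivariate.swap_X
    · congr 1
      · exact Polynomial.Bivariate.swap_Y
      · exact Multiset.map_congr rfl fun a _ => Polynomial.Bivariate.swap_C_C a
  have hcoeff : ∀ (p : R[X][X]) (a b : ℕ),
      ((Polynomial.Bivariate.swap p).coeff a).coeff b = (p.coeff b).coeff a := by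
    intro p a b
    induction p using Polynomial.induction_on' with
    | add p q hp hq => simp only [map_add, coeff_add, hp, hq]
    | monomial i q =>
      induction q using Polynomial.induction_on' with
      | add p q hp hq => simp only [map_add, coeff_add, hp, hq]
      | monomial j x =>
        rw [Polynomial.Bivariate.swap_monomial_monomial]
        simp only [coeff_monomial]
        split_ifs <;> simp_all [coeff_monomial]
  rw [← hswap, hcoeff]
  have h0 := h (X ::ₘ s.map C) n hn
  rw [Multiset.map_cons, Multiset.map_map] at h0
  rw [h0, coeff_zero]

/-- Homogeneity of the coefficients, up to a power of the scalar, from the substitution of `c X`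
for the variable `X`. -/
theorem IsHomogeneous.pow_mul_varCoeff {F : SymFun} {d : ℕ} (h : F.IsHomogeneous d) (r : ℕ)
    {R : Type} [CommRing R] (c : R) (s : Multiset R) :
    c ^ r * (F.varCoeff r).eval (s.map (c * ·)) = c ^ d * (F.varCoeff r).eval s := by
  have h1 := h (C c) (X ::ₘ s.map C)
  have h2 := F.map_eval (Polynomial.compRingHom (C c * X)) (X ::ₘ (s.map (c * ·)).map C)
  have h3 : ((X : R[X]) ::ₘ (s.map (c * ·)).map C).map (Polynomial.compRingHom (C c * X)) =
      (X ::ₘ s.map C).map (C c * ·) := by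
    simp only [Multiset.map_cons, Multiset.map_map, coe_compRingHom_apply, X_comp]
    congr 1
    refine Multiset.map_congr rfl fun a _ => ?_
    simp
  rw [h3, h1, coe_compRingHom_apply] at h2
  have h4 := congrArg (fun p => Polynomial.coeff p r) h2
  simp only [comp_C_mul_X_coeff, ← C_pow, coeff_C_mul] at h4
  rw [varCoeff_eval, varCoeff_eval, mul_comm, h4]

/-- With a variable in place of the scalar, the power of the scalar can be cancelled. -/
theorem IsHomogeneous.varCoeff {F : SymFun} {d : ℕ} (h : F.IsHomogeneous d) {r : ℕ}
    (hr : r ≤ d) : (F.varCoeff r).IsHomogeneous (d - r) := by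
  intro R _ c s
  have h1 := h.pow_mul_varCoeff r (X : R[X]) (s.map C)
  have h2 : (F.varCoeff r).eval ((s.map C).map ((X : R[X]) * ·)) =
      X ^ (d - r) * (F.varCoeff r).eval (s.map C) := by
    refine (Polynomial.monic_X_pow (R := R) r).isRegular.left ?_
    simp only
    rw [h1, ← mul_assoc, ← pow_add, Nat.add_sub_cancel' hr]
  have h3 := congrArg (Polynomial.evalRingHom c) h2
  rw [map_mul, map_eval, map_eval, Multiset.map_map, Multiset.map_map, Multiset.map_map] at h3
  simpa [Function.comp_def] using h3

theorem IsHomogeneous.varCoeff_eq_zero {F : SymFun} {d : ℕ} (h : F.IsHomogeneous d) {r : ℕ}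
    (hr : d < r) {R : Type} [CommRing R] (s : Multiset R) : (F.varCoeff r).eval s = 0 := by
  have h1 := h.pow_mul_varCoeff r (X : R[X]) (s.map C)
  have h2 := congrArg (fun p => Polynomial.coeff p d) h1
  rw [show (F.varCoeff r).eval (s.map C) = C ((F.varCoeff r).eval s) from
    ((F.varCoeff r).map_eval C s).symm] at h2
  simp only [coeff_X_pow_mul', le_refl, if_true, Nat.sub_self, coeff_C_zero,
    if_neg (not_le.2 hr)] at h2
  exact h2.symm

/-- A symmetric function that has degree zero in each variable is constant. -/
theorem DegreeLE.eval_eq {F : SymFun} (h : F.DegreeLE 0) {R : Type} [CommRing R]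
    (s : Multiset R) : F.eval s = F.eval (0 : Multiset R) := by
  induction s using Multiset.induction_on with
  | empty => rfl
  | cons t s ih =>
    have h1 : ∀ u : R, F.eval (u ::ₘ s) = (F.eval (X ::ₘ s.map C)).coeff 0 := by
      intro u
      have h2 := F.map_eval (Polynomial.evalRingHom u) (X ::ₘ s.map C)
      rw [Polynomial.eq_C_of_natDegree_eq_zero
        (Nat.le_zero.1 (natDegree_le_iff_coeff_eq_zero.2 fun n hn => h s n hn))] at h2
      rw [Multiset.map_cons, Multiset.map_map] at h2
      simpa [Function.comp_def] using h2.symm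
    rw [h1, ← h1 0, F.eval_zero_cons, ih]

/-- Every homogeneous symmetric function is an integral combination of Schur functions. The top
coefficient in one variable is such a combination by induction, and putting a row on top of each
of its diagrams gives a combination with the same top coefficient. -/
theorem exists_eq_ofCoeffs (d : ℕ) : ∀ (r : ℕ) (F : SymFun), F.IsHomogeneous d → F.DegreeLE r →
    ∃ c : YoungDiagram →₀ ℤ, (∀ π ∈ c.support, π.card = d ∧ π.rowLen 0 ≤ r) ∧
      ∀ {R : Type} [CommRing R] (s : Multiset R), F.eval s = (ofCoeffs c).eval s := by
  classical
  induction d using Nat.strong_induction_on with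
  | _ d ihd =>
  intro r
  induction r with
  | zero =>
    intro F hF h0
    rcases Nat.eq_zero_or_pos d with rfl | hd
    · refine ⟨Finsupp.single ⊥ (F.eval (0 : Multiset ℤ)), ?_, ?_⟩
      · intro π hπ
        obtain rfl : π = ⊥ := Finset.mem_singleton.1 (Finsupp.support_single_subset hπ)
        exact ⟨rfl, (YoungDiagram.rowLen_bot 0).le⟩
      · intro R _ s
        rw [ofCoeffs_eval, Finsupp.sum_single_index, schurEval_bot, h0.eval_eq,
          zsmul_one, ← eq_intCast (Int.castRingHom R), F.map_eval, Multiset.map_zero]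
        rw [zero_smul]
    · refine ⟨0, by simp, ?_⟩
      intro R _ s
      have h1 := hF (0 : R) 0
      rw [zero_pow hd.ne', zero_mul, Multiset.map_zero] at h1
      rw [h0.eval_eq, h1]
      rfl
  | succ r ihr =>
    intro F hF hr
    by_cases hd : r + 1 ≤ d
    · obtain ⟨c, hc, hcF⟩ := ihd (d - (r + 1)) (by omega) (r + 1) _ (hF.varCoeff hd)
        (hr.varCoeff (r + 1))
      let c₁ : YoungDiagram →₀ ℤ := c.mapDomain (YoungDiagram.consRow (r + 1))
      have hc₁ : ∀ π ∈ c₁.support, π.card = d ∧ π.rowLen 0 ≤ r + 1 := by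
        intro π hπ
        obtain ⟨ν, hν, rfl⟩ := Finset.mem_image.1 (Finsupp.mapDomain_support hπ)
        obtain ⟨h1, h2⟩ := hc ν hν
        rw [YoungDiagram.card_consRow h2, YoungDiagram.rowLen_consRow_zero]
        omega
      have hcoeff : ∀ {R : Type} [CommRing R] (s : Multiset R),
          ((ofCoeffs c₁).eval (X ::ₘ s.map C)).coeff (r + 1) = (ofCoeffs c).eval s := by
        intro R _ s
        rw [coeff_ofCoeffs, Finsupp.sum_mapDomain_index (fun _ => by rw [zero_smul])
          (fun _ _ _ => by rw [add_smul]), ofCoeffs_eval]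
        refine Finsupp.sum_congr fun ν hν => ?_
        have h1 := coeff_schurEval_rowLen_zero (YoungDiagram.consRow (r + 1) ν) s
        rw [YoungDiagram.rowLen_consRow_zero, YoungDiagram.tail_consRow (hc ν hν).2] at h1
        rw [h1]
      -- The combination `c₁` has the same coefficient of `X ^ (r + 1)` as `F`, so that the
      -- difference has degree at most `r` in each variable.
      obtain ⟨c₂, hc₂, hF₂⟩ := ihr (F.sub (ofCoeffs c₁))
        (hF.sub (ofCoeffs_isHomogeneous fun π hπ => (hc₁ π hπ).1)) (by
          intro R _ s n hn
          rw [sub_eval, coeff_sub]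
          rcases Nat.lt_or_eq_of_le (Nat.succ_le_of_lt hn) with h1 | rfl
          · rw [hr s n h1, coeff_ofCoeffs, Finsupp.sum, Finset.sum_eq_zero, sub_zero]
            intro π hπ
            rw [coeff_schurEval_of_lt ((hc₁ π hπ).2.trans_lt h1), smul_zero]
          · rw [hcoeff, ← hcF, varCoeff_eval, sub_self])
      refine ⟨c₁ + c₂, ?_, ?_⟩
      · intro π hπ
        rcases Finset.mem_union.1 (Finsupp.support_add hπ) with h1 | h1
        · exact hc₁ π h1
        · exact ⟨(hc₂ π h1).1, (hc₂ π h1).2.trans (Nat.le_succ r)⟩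
      · intro R _ s
        have h1 := hF₂ s
        rw [sub_eval, sub_eq_iff_eq_add] at h1
        rw [h1, ofCoeffs_eval, ofCoeffs_eval, ofCoeffs_eval,
          Finsupp.sum_add_index' (fun _ => by rw [zero_smul]) (fun _ _ _ => by rw [add_smul]),
          add_comm]
    · obtain ⟨c, hc, hcF⟩ := ihr F hF (by
        intro R _ s n hn
        exact hF.varCoeff_eq_zero (by omega) s)
      exact ⟨c, fun π hπ => ⟨(hc π hπ).1, (hc π hπ).2.trans (Nat.le_succ r)⟩, hcF⟩

end SymFun

end SymFun

/-! ### The plethysm with `e₂` -/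

section Plethysm

open Polynomial

/-- The products of the two-element submultisets: the monomials of `e₂`. -/
def pairProducts {R : Type*} [CommMonoid R] (s : Multiset R) : Multiset R :=
  (s.powersetCard 2).map Multiset.prod

theorem pairProducts_cons {R : Type*} [CommMonoid R] (t : R) (s : Multiset R) :
    pairProducts (t ::ₘ s) = pairProducts s + s.map (t * ·) := by
  rw [pairProducts, Multiset.powersetCard_cons, Multiset.map_add, Multiset.powersetCard_one,
    Multiset.map_map, Multiset.map_map, pairProducts]
  congr 1
  exact Multiset.map_congr rfl fun a _ => by simp

theorem map_pairProducts {R S : Type*} [CommMonoid R] [CommMonoid S] (φ : R →* S)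
    (s : Multiset R) : (pairProducts s).map φ = pairProducts (s.map φ) := by
  rw [pairProducts, pairProducts, Multiset.powersetCard_map, Multiset.map_map, Multiset.map_map]
  exact Multiset.map_congr rfl fun a _ => by simp [map_multiset_prod]

theorem pairProducts_map_mul {R : Type*} [CommMonoid R] (c : R) (s : Multiset R) :
    pairProducts (s.map (c * ·)) = (pairProducts s).map (c ^ 2 * ·) := by
  rw [pairProducts, pairProducts, Multiset.powersetCard_map, Multiset.map_map, Multiset.map_map]
  refine Multiset.map_congr rfl fun a ha => ?_
  have h := (Multiset.mem_powersetCard.1 ha).2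
  have h1 := Multiset.prod_map_mul (m := a) (f := fun _ => c) (g := fun x => x)
  rw [Multiset.map_const', Multiset.prod_replicate, h, Multiset.map_id'] at h1
  exact h1

theorem schurEval_add_map_zero_mul {R : Type*} [CommSemiring R] (μ : YoungDiagram)
    (s u : Multiset R) : schurEval μ (s + u.map (0 * ·)) = schurEval μ s := by
  induction u using Multiset.induction_on with
  | empty => rw [Multiset.map_zero, add_zero]
  | cons t u ih => rw [Multiset.map_cons, zero_mul, Multiset.add_cons, schurEval_zero_cons, ih]

namespace SymFun

/-- The plethysm `s_μ ∘ e₂`. -/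
noncomputable def plethysmE2 (μ : YoungDiagram) : SymFun where
  eval s := schurEval μ (pairProducts s)
  map_eval φ s := by
    rw [map_schurEval]
    exact congrArg _ (map_pairProducts φ.toMonoidHom s)
  eval_zero_cons s := by rw [pairProducts_cons, schurEval_add_map_zero_mul]

theorem plethysmE2_eval (μ : YoungDiagram) {R : Type} [CommRing R] (s : Multiset R) :
    (plethysmE2 μ).eval s = schurEval μ (pairProducts s) := rfl

theorem plethysmE2_isHomogeneous (μ : YoungDiagram) :
    (plethysmE2 μ).IsHomogeneous (2 * μ.card) := by
  intro R _ c s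
  rw [plethysmE2_eval, plethysmE2_eval, pairProducts_map_mul, schurEval_map_mul, pow_mul]

theorem plethysmE2_eval_X_cons (μ : YoungDiagram) {R : Type} [CommRing R] (s : Multiset R) :
    (plethysmE2 μ).eval (X ::ₘ s.map C) =
      schurEval μ ((pairProducts s).map C + (s.map C).map (X * ·)) := by
  rw [plethysmE2_eval, pairProducts_cons]
  congr 2
  exact (map_pairProducts (C : R →+* R[X]).toMonoidHom s).symm

theorem plethysmE2_degreeLE (μ : YoungDiagram) : (plethysmE2 μ).DegreeLE μ.card := by
  intro R _ s n hn
  rw [plethysmE2_eval_X_cons]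
  exact coeff_eq_zero_of_natDegree_lt ((natDegree_schurEval_add_le μ _ _).trans_lt hn)

/-- The coefficient of `s_{(k, μ)}` in `s_μ ∘ e₂` is `1`, where `k = |μ|`: the coefficient of the
`k`-th power of one variable is `s_μ`. -/
theorem exists_plethysmE2_eq (μ : YoungDiagram) :
    ∃ c : YoungDiagram →₀ ℤ,
      (∀ {R : Type} [CommRing R] (s : Multiset R), (plethysmE2 μ).eval s = (ofCoeffs c).eval s) ∧
      c (YoungDiagram.consRow μ.card μ) = 1 := by
  classical
  obtain ⟨c, hc, hF⟩ := exists_eq_ofCoeffs (2 * μ.card) μ.card _ (plethysmE2_isHomogeneous μ)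
    (plethysmE2_degreeLE μ)
  refine ⟨c, hF, ?_⟩
  have hμ := μ.rowLen_zero_le_card
  let B := c.support.filter fun π => π.rowLen 0 = μ.card
  have hinj : ∀ π ∈ B, YoungDiagram.consRow μ.card π.tail = π := by
    intro π hπ
    rw [← (Finset.mem_filter.1 hπ).2]
    exact YoungDiagram.consRow_tail π
  -- Both sides are the coefficient of `X ^ |μ|` in one variable. The diagram `μ` is inserted into
  -- the index set because it is not yet known that `(k, μ)` occurs in the expansion.
  have key : ∀ {R : Type} [CommRing R] (s : Multiset R),
      schurEval μ s = ∑ ν ∈ insert μ (B.image YoungDiagram.tail),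
        c (YoungDiagram.consRow μ.card ν) • schurEval ν s := by
    intro R _ s
    have h1 : schurEval μ s = ∑ π ∈ B, c π • schurEval π.tail s := by
      rw [← coeff_schurEval_add μ (pairProducts s) s, ← plethysmE2_eval_X_cons, hF,
        coeff_ofCoeffs, Finsupp.sum, Finset.sum_filter]
      refine Finset.sum_congr rfl fun π hπ => ?_
      split_ifs with h2
      · rw [← h2, coeff_schurEval_rowLen_zero]
      · rw [coeff_schurEval_of_lt (lt_of_le_of_ne (hc π hπ).2 h2), smul_zero]
    rw [h1]
    have h2 : ∑ ν ∈ B.image YoungDiagram.tail,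
        c (YoungDiagram.consRow μ.card ν) • schurEval ν s = ∑ π ∈ B, c π • schurEval π.tail s := by
      rw [Finset.sum_image fun π hπ π' hπ' he => by rw [← hinj π hπ, ← hinj π' hπ', he]]
      exact Finset.sum_congr rfl fun π hπ => by rw [hinj π hπ]
    rw [← h2]
    refine Finset.sum_subset (Finset.subset_insert _ _) fun ν hν hn => ?_
    obtain rfl : ν = μ := (Finset.mem_insert.1 hν).resolve_right hn
    have h3 : c (YoungDiagram.consRow ν.card ν) = 0 := by
      by_contra h4
      refine hn (Finset.mem_image.2 ⟨_, Finset.mem_filter.2 ⟨Finsupp.mem_support_iff.2 h4,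
        YoungDiagram.rowLen_consRow_zero _ _⟩, YoungDiagram.tail_consRow hμ⟩)
    rw [h3, zero_smul]
  have hz := eq_zero_of_sum_smul_schurEval_eq_zero
    ((insert μ (B.image YoungDiagram.tail)).sup YoungDiagram.card)
    (insert μ (B.image YoungDiagram.tail))
    (fun ν => c (YoungDiagram.consRow μ.card ν) - if ν = μ then 1 else 0)
    (fun π hπ => Finset.le_sup (f := YoungDiagram.card) hπ) (by
      intro R _ s
      simp only [sub_smul, Finset.sum_sub_distrib]
      rw [← key s, Finset.sum_eq_single_of_mem μ (Finset.mem_insert_self _ _), if_pos rfl,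
        one_smul, sub_self]
      intro ν _ hn
      rw [if_neg hn, zero_smul]) μ (Finset.mem_insert_self _ _)
  simp only [if_true] at hz
  exact sub_eq_zero.1 hz

end SymFun

theorem schurPoly_eq_schurEval (μ : YoungDiagram) (N : ℕ) :
    schurPoly μ N =
      schurEval μ ((Finset.univ : Finset (Fin N)).val.map (MvPolynomial.X (R := ℤ))) := by
  rw [← aeval_schurPoly, MvPolynomial.aeval_X_left]
  rfl

theorem sum_single_one_injective (N : ℕ) :
    Function.Injective fun t : Finset (Fin N) => ∑ i ∈ t, Finsupp.single i 1 := by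
  classical
  intro t u h
  ext i
  have h1 := DFunLike.congr_fun h i
  simp only [Finsupp.finsetSum_apply, Finsupp.single_apply, Finset.sum_ite_eq'] at h1
  split_ifs at h1 <;> simp_all

theorem coeff_esymm_of_mem {N n : ℕ} {m : Fin N →₀ ℕ}
    (hm : m ∈ (MvPolynomial.esymm (Fin N) ℕ n).support) :
    (MvPolynomial.esymm (Fin N) ℕ n).coeff m = 1 := by
  classical
  rw [MvPolynomial.support_esymm] at hm
  obtain ⟨t, ht, rfl⟩ := Finset.mem_image.1 hm
  rw [MvPolynomial.esymm_eq_sum_monomial, MvPolynomial.coeff_sum,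
    Finset.sum_eq_single_of_mem t ht, MvPolynomial.coeff_monomial, if_pos rfl]
  intro u _ hu
  rw [MvPolynomial.coeff_monomial, if_neg fun h => hu (sum_single_one_injective N h)]

/-- The letters substituted in the plethysm with `e₂` are the products of two distinct variables,
each once. -/
theorem map_monomialLetters_esymm_two (N : ℕ) :
    (Finset.univ : Finset (MonomialLetters (MvPolynomial.esymm (Fin N) ℕ 2))).val.map
      (fun x => MvPolynomial.monomial x.1.1 (1 : ℤ)) =
    pairProducts ((Finset.univ : Finset (Fin N)).val.map (MvPolynomial.X (R := ℤ))) := by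
  classical
  have h1 : ∀ {α β : Type} (s : Finset α) (f : α → β),
      s.val.map f = ∑ x ∈ s, ({f x} : Multiset β) := by
    intro α β s f
    have h2 := Multiset.sum_map_singleton (s.val.map f)
    rw [Multiset.map_map] at h2
    exact h2.symm
  rw [h1, Fintype.sum_sigma]
  simp only [Finset.sum_const, Finset.card_univ, Fintype.card_fin]
  rw [Finset.sum_coe_sort (MvPolynomial.esymm (Fin N) ℕ 2).support fun m =>
    (MvPolynomial.esymm (Fin N) ℕ 2).coeff m •
      ({MvPolynomial.monomial m (1 : ℤ)} : Multiset (MvPolynomial (Fin N) ℤ))]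
  rw [Finset.sum_congr rfl fun m hm => by rw [coeff_esymm_of_mem hm, one_smul],
    MvPolynomial.support_esymm, Finset.sum_image fun t _ u _ h => sum_single_one_injective N h,
    ← h1, pairProducts, Multiset.powersetCard_map, Multiset.map_map,
    ← Finset.map_val_val_powersetCard, Multiset.map_map]
  refine Multiset.map_congr rfl fun t _ => ?_
  rw [MvPolynomial.monomial_sum_one]
  rfl

theorem plethysm_esymm_two (μ : YoungDiagram) (N : ℕ) :
    plethysm (schurPoly μ) (MvPolynomial.esymm (Fin N) ℕ 2) =
      (SymFun.plethysmE2 μ).eval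
        ((Finset.univ : Finset (Fin N)).val.map (MvPolynomial.X (R := ℤ))) := by
  rw [plethysm, aeval_schurPoly, SymFun.plethysmE2_eval, ← map_monomialLetters_esymm_two]
  congr 1
  rw [← Finset.map_univ_equiv
    (Fintype.equivFin (MonomialLetters (MvPolynomial.esymm (Fin N) ℕ 2))).symm,
    Finset.map_val, Multiset.map_map]
  rfl

theorem exists_fin_map_eq {R : Type*} (s : Multiset R) :
    ∃ (N : ℕ) (g : Fin N → R), s = (Finset.univ : Finset (Fin N)).val.map g := by
  refine ⟨s.toList.length, s.toList.get, ?_⟩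
  rw [Fin.univ_val_map, List.ofFn_get, Multiset.coe_toList]

/-- An identity of symmetric polynomials in all numbers of variables is the same as an identity of
symmetric functions, by evaluation of the polynomials. -/
theorem isSchurExpansion_plethysm_iff {μ : YoungDiagram} {c : YoungDiagram →₀ ℤ} :
    IsSchurExpansion (fun N => plethysm (schurPoly μ) (MvPolynomial.esymm (Fin N) ℕ 2)) c ↔
      ∀ {R : Type} [CommRing R] (s : Multiset R),
        (SymFun.plethysmE2 μ).eval s = (SymFun.ofCoeffs c).eval s := by
  constructor
  · intro h R _ s
    obtain ⟨N, g, rfl⟩ := exists_fin_map_eq s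
    have h1 := h N
    simp only [plethysm_esymm_two, schurPoly_eq_schurEval] at h1
    have h2 : ∀ F : SymFun, F.eval ((Finset.univ : Finset (Fin N)).val.map g) =
        (MvPolynomial.aeval g : MvPolynomial (Fin N) ℤ →ₐ[ℤ] R).toRingHom
          (F.eval ((Finset.univ : Finset (Fin N)).val.map (MvPolynomial.X (R := ℤ)))) := by
      intro F
      rw [F.map_eval, Multiset.map_map]
      congr 1
      exact Multiset.map_congr rfl fun i _ => (MvPolynomial.aeval_X g i).symm
    rw [h2, h2, h1]
    rfl
  · intro h N
    simp only [plethysm_esymm_two, schurPoly_eq_schurEval]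
    exact h _

theorem plethysm_expansion (μ : YoungDiagram) :
    ∃ c : YoungDiagram →₀ ℤ,
      IsSchurExpansion (fun N => plethysm (schurPoly μ) (MvPolynomial.esymm (Fin N) ℕ 2)) c ∧
      (∀ c' : YoungDiagram →₀ ℤ,
        IsSchurExpansion (fun N => plethysm (schurPoly μ) (MvPolynomial.esymm (Fin N) ℕ 2)) c' →
          c' = c) ∧
      c (YoungDiagram.consRow μ.card μ) = 1 := by
  classical
  obtain ⟨c, hc, h1⟩ := SymFun.exists_plethysmE2_eq μ
  refine ⟨c, isSchurExpansion_plethysm_iff.2 hc, fun c' hc' => ?_, h1⟩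
  rw [isSchurExpansion_plethysm_iff] at hc'
  have hz := eq_zero_of_sum_smul_schurEval_eq_zero ((c'.support ∪ c.support).sup YoungDiagram.card)
    (c'.support ∪ c.support) (fun π => c' π - c π)
    (fun π hπ => Finset.le_sup (f := YoungDiagram.card) hπ) (by
      intro R _ s
      have h2 : (SymFun.ofCoeffs c').eval s = (SymFun.ofCoeffs c).eval s :=
        (hc' s).symm.trans (hc s)
      rw [SymFun.ofCoeffs_eval, SymFun.ofCoeffs_eval,
        Finsupp.sum_of_support_subset c' (s := c'.support ∪ c.support) Finset.subset_union_left _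
          (fun _ _ => by rw [zero_smul]),
        Finsupp.sum_of_support_subset c (s := c'.support ∪ c.support) Finset.subset_union_right _
          (fun _ _ => by rw [zero_smul])] at h2
      simp only [sub_smul, Finset.sum_sub_distrib, h2, sub_self])
  ext π
  by_cases hπ : π ∈ c'.support ∪ c.support
  · exact sub_eq_zero.1 (hz π hπ)
  · rw [Finset.mem_union, not_or, Finsupp.notMem_support_iff, Finsupp.notMem_support_iff] at hπ
    rw [hπ.1, hπ.2]

end Plethysm

/-! ### Column antisymmetrizers and polytabloids -/

section ColumnAntisymmetrizer

theorem perm_apply_inv_apply {α : Type*} (σ : Equiv.Perm α) (x : α) : σ (σ⁻¹ x) = x :=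
  σ.apply_symm_apply x

theorem tabloidRep_single {n : ℕ} (g : Equiv.Perm (Fin n)) (r : Fin n → ℕ) (a : ℂ) :
    tabloidRep n g (Finsupp.single r a) = Finsupp.single (fun i => r (g⁻¹ i)) a := by
  simp [tabloidRep, Finsupp.mapDomain_single]

theorem tabloidRep_apply_apply {n : ℕ} (g : Equiv.Perm (Fin n)) (v : (Fin n → ℕ) →₀ ℂ)
    (r : Fin n → ℕ) : tabloidRep n g v r = v fun i => r (g i) := by
  induction v using Finsupp.induction_linear with
  | zero => simp
  | add v w hv hw => rw [map_add, Finsupp.add_apply, hv, hw, Finsupp.add_apply]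
  | single r' a =>
    rw [tabloidRep_single]
    classical
    rw [Finsupp.single_apply, Finsupp.single_apply]
    congr 1
    refine propext ⟨?_, ?_⟩
    · rintro rfl
      funext i
      simp
    · rintro rfl
      funext i
      simp

variable {n : ℕ}

/-- The signed sum of the permutations that preserve the columns, where `col i` is the column of
the label `i`. -/
noncomputable def colAntisymmetrizer (col : Fin n → ℕ) : Module.End ℂ ((Fin n → ℕ) →₀ ℂ) :=
  ∑ σ : Equiv.Perm (Fin n) with ∀ i, col (σ i) = col i,
    ((Equiv.Perm.sign σ : ℤ) : ℂ) • tabloidRep n σ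

theorem colAntisymmetrizer_apply (col : Fin n → ℕ) (v : (Fin n → ℕ) →₀ ℂ) :
    colAntisymmetrizer col v = ∑ σ : Equiv.Perm (Fin n) with ∀ i, col (σ i) = col i,
      ((Equiv.Perm.sign σ : ℤ) : ℂ) • tabloidRep n σ v := by
  simp [colAntisymmetrizer, LinearMap.sum_apply]

theorem polytabloid_eq {μ : YoungDiagram} (t : Fin n ≃ {c // c ∈ μ.cells}) :
    polytabloid t = colAntisymmetrizer (fun i => (t i).1.2)
      (Finsupp.single (fun i => (t i).1.1) 1) := by
  rw [colAntisymmetrizer_apply, polytabloid]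

theorem sign_mul_sign_self (τ : Equiv.Perm (Fin n)) :
    ((Equiv.Perm.sign τ : ℤ) : ℂ) * ((Equiv.Perm.sign τ : ℤ) : ℂ) = 1 := by
  rw [← Int.cast_mul, ← Units.val_mul, Int.units_mul_self, Units.val_one, Int.cast_one]

theorem colAntisymmetrizer_tabloidRep {col : Fin n → ℕ} {τ : Equiv.Perm (Fin n)}
    (hτ : ∀ i, col (τ i) = col i) (v : (Fin n → ℕ) →₀ ℂ) :
    colAntisymmetrizer col (tabloidRep n τ v) =
      ((Equiv.Perm.sign τ : ℤ) : ℂ) • colAntisymmetrizer col v := by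
  rw [colAntisymmetrizer_apply, colAntisymmetrizer_apply, Finset.smul_sum]
  refine Finset.sum_bij' (fun σ _ => σ * τ) (fun σ _ => σ * τ⁻¹) ?_ ?_ ?_ ?_ ?_
  · intro σ hσ
    simp only [Finset.mem_filter, Finset.mem_univ, true_and] at hσ ⊢
    intro i
    rw [Equiv.Perm.mul_apply, hσ, hτ]
  · intro σ hσ
    simp only [Finset.mem_filter, Finset.mem_univ, true_and] at hσ ⊢
    intro i
    rw [Equiv.Perm.mul_apply, hσ, ← hτ, perm_apply_inv_apply]
  · intro σ _
    group
  · intro σ _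
    group
  · intro σ _
    rw [smul_smul, map_mul, map_mul, Units.val_mul, Int.cast_mul, mul_left_comm,
      sign_mul_sign_self, mul_one]
    rfl

theorem tabloidRep_colAntisymmetrizer {col : Fin n → ℕ} {τ : Equiv.Perm (Fin n)}
    (hτ : ∀ i, col (τ i) = col i) (v : (Fin n → ℕ) →₀ ℂ) :
    tabloidRep n τ (colAntisymmetrizer col v) =
      ((Equiv.Perm.sign τ : ℤ) : ℂ) • colAntisymmetrizer col v := by
  rw [colAntisymmetrizer_apply, map_sum, Finset.smul_sum]
  refine Finset.sum_bij' (fun σ _ => τ * σ) (fun σ _ => τ⁻¹ * σ) ?_ ?_ ?_ ?_ ?_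
  · intro σ hσ
    simp only [Finset.mem_filter, Finset.mem_univ, true_and] at hσ ⊢
    intro i
    rw [Equiv.Perm.mul_apply, hτ, hσ]
  · intro σ hσ
    simp only [Finset.mem_filter, Finset.mem_univ, true_and] at hσ ⊢
    intro i
    rw [Equiv.Perm.mul_apply, ← hτ, perm_apply_inv_apply, hσ]
  · intro σ _
    group
  · intro σ _
    group
  · intro σ _
    rw [map_smul, smul_smul, map_mul, map_mul, Units.val_mul, Int.cast_mul, ← mul_assoc,
      sign_mul_sign_self, one_mul]
    rfl

/-- A tabloid with two labels of the same column in the same row is killed: exchanging these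
labels fixes the tabloid and changes the sign. -/
theorem colAntisymmetrizer_single_eq_zero {col : Fin n → ℕ} {r : Fin n → ℕ} {i j : Fin n}
    (hij : i ≠ j) (hcol : col i = col j) (hr : r i = r j) :
    colAntisymmetrizer col (Finsupp.single r 1) = 0 := by
  have h1 : tabloidRep n (Equiv.swap i j) (Finsupp.single r 1) = Finsupp.single r 1 := by
    rw [tabloidRep_single]
    congr 1
    funext x
    rw [Equiv.swap_inv, Equiv.swap_apply_def]
    split_ifs with h h
    · rw [h, hr]
    · rw [h, hr]
    · rfl
  have h2 := colAntisymmetrizer_tabloidRep (col := col) (τ := Equiv.swap i j) (fun x => by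
    rw [Equiv.swap_apply_def]
    split_ifs with h h
    · rw [h, hcol]
    · rw [h, hcol]
    · rfl) (Finsupp.single r 1)
  rw [h1, Equiv.Perm.sign_swap hij] at h2
  simpa [self_eq_neg] using h2

variable {μ : YoungDiagram}

/-- If the labels of each column of `t` lie in different rows of the tabloid `r`, and the sum of
the row indices is that of `t`, then `r` arises from `t` by a column permutation. The number
`row - column length` is negative exactly on the cells of `μ`, so that moving cells out of `μ`
within their columns would increase the sum. -/
theorem exists_perm_of_injective (t : Fin n ≃ {c // c ∈ μ.cells}) (r : Fin n → ℕ)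
    (hinj : Function.Injective fun i => (r i, (t i).1.2))
    (hsum : ∑ i, r i = ∑ i, (t i).1.1) :
    ∃ τ : Equiv.Perm (Fin n), (∀ i, (t (τ i)).1.2 = (t i).1.2) ∧ ∀ i, (t (τ i)).1.1 = r i := by
  classical
  -- Both `S` and the cells of `μ` have the same sum of `g`, and the same size.
  let g : ℕ × ℕ → ℤ := fun c => (c.1 : ℤ) - μ.colLen c.2
  let S : Finset (ℕ × ℕ) := Finset.univ.image fun i => (r i, (t i).1.2)
  have hS : ∑ c ∈ S, g c = ∑ c ∈ μ.cells, g c := by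
    rw [Finset.sum_image fun i _ j _ h => hinj h, ← Finset.sum_coe_sort μ.cells,
      ← Equiv.sum_comp t]
    simp only [g, Finset.sum_sub_distrib]
    rw [← Nat.cast_sum, hsum, Nat.cast_sum]
  have hcard : S.card = μ.cells.card := by
    rw [Finset.card_image_of_injective _ hinj, Finset.card_univ, Fintype.card_congr t,
      Fintype.card_coe]
  rw [← Finset.sum_inter_add_sum_sdiff S μ.cells, ← Finset.sum_inter_add_sum_sdiff μ.cells S,
    Finset.inter_comm μ.cells S, add_right_inj] at hS
  have h1 : 0 ≤ ∑ c ∈ S \ μ.cells, g c := by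
    refine Finset.sum_nonneg ?_
    rintro ⟨i, j⟩ hc
    have h2 : ¬ i < μ.colLen j := fun h =>
      (Finset.mem_sdiff.1 hc).2 ((YoungDiagram.mem_cells _).2 (YoungDiagram.mem_iff_lt_colLen.2 h))
    simp only [g]
    omega
  have h2 : ∑ c ∈ μ.cells \ S, g c ≤ ∑ c ∈ μ.cells \ S, (-1 : ℤ) := by
    refine Finset.sum_le_sum ?_
    rintro ⟨i, j⟩ hc
    have h2 : i < μ.colLen j :=
      YoungDiagram.mem_iff_lt_colLen.1 ((YoungDiagram.mem_cells _).1 (Finset.mem_sdiff.1 hc).1)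
    simp only [g]
    omega
  rw [Finset.sum_const, smul_neg, nsmul_one] at h2
  have h3 : (μ.cells \ S).card = 0 := by omega
  have h4 : μ.cells = S := Finset.eq_of_subset_of_card_le
    (Finset.sdiff_eq_empty_iff_subset.1 (Finset.card_eq_zero.1 h3)) hcard.le
  have h5 : ∀ i, (r i, (t i).1.2) ∈ μ.cells := fun i => by
    exact h4.ge (Finset.mem_image_of_mem (fun i => (r i, (t i).1.2)) (Finset.mem_univ i))
  have h6 : Function.Injective fun i => t.symm ⟨(r i, (t i).1.2), h5 i⟩ := by
    intro i j h
    exact hinj (Subtype.ext_iff.1 (t.symm.injective h))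
  refine ⟨Equiv.ofBijective _ (Finite.injective_iff_bijective.1 h6), fun i => ?_, fun i => ?_⟩
  · simp only [Equiv.ofBijective_apply, Equiv.apply_symm_apply]
  · simp only [Equiv.ofBijective_apply, Equiv.apply_symm_apply]

/-- The column antisymmetrizer of `t` maps every tabloid to a multiple of the polytabloid of `t`. -/
theorem colAntisymmetrizer_mem_span (t : Fin n ≃ {c // c ∈ μ.cells}) {v : (Fin n → ℕ) →₀ ℂ}
    (hv : ∀ r, v r ≠ 0 → ∑ i, r i = ∑ i, (t i).1.1) :
    colAntisymmetrizer (fun i => (t i).1.2) v ∈ Submodule.span ℂ {polytabloid t} := by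
  have h1 : v = ∑ r ∈ v.support, v r • Finsupp.single r 1 := by
    conv_lhs => rw [← Finsupp.sum_single v]
    rw [Finsupp.sum]
    exact Finset.sum_congr rfl fun r _ => by rw [Finsupp.smul_single', mul_one]
  rw [h1, map_sum]
  refine Submodule.sum_mem _ fun r hr => ?_
  rw [map_smul]
  refine Submodule.smul_mem _ _ ?_
  by_cases hinj : Function.Injective fun i => (r i, (t i).1.2)
  · obtain ⟨τ, hτ, hr'⟩ := exists_perm_of_injective t r hinj (hv r (Finsupp.mem_support_iff.1 hr))
    have h2 : Finsupp.single r (1 : ℂ) =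
        tabloidRep n τ⁻¹ (Finsupp.single (fun i => (t i).1.1) 1) := by
      rw [tabloidRep_single, inv_inv]
      congr 1
      funext i
      exact (hr' i).symm
    rw [h2, colAntisymmetrizer_tabloidRep (fun i => by
      rw [← hτ (τ⁻¹ i), perm_apply_inv_apply]), ← polytabloid_eq]
    exact Submodule.smul_mem _ _ (Submodule.mem_span_singleton_self _)
  · obtain ⟨i, j, hij, hne⟩ : ∃ i j, (r i, (t i).1.2) = (r j, (t j).1.2) ∧ i ≠ j := by
      simpa only [Function.Injective, not_forall, exists_prop] using hinj
    rw [colAntisymmetrizer_single_eq_zero hne (Prod.ext_iff.1 hij).2 (Prod.ext_iff.1 hij).1]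
    exact Submodule.zero_mem _

theorem polytabloid_apply (t : Fin n ≃ {c // c ∈ μ.cells}) (r : Fin n → ℕ) :
    polytabloid t r = ∑ σ : Equiv.Perm (Fin n) with ∀ i, (t (σ i)).1.2 = (t i).1.2,
      ((Equiv.Perm.sign σ : ℤ) : ℂ) * if (∀ i, (t (σ i)).1.1 = r i) then 1 else 0 := by
  classical
  rw [polytabloid, Finsupp.finsetSum_apply]
  refine Finset.sum_bij' (fun σ _ => σ⁻¹) (fun σ _ => σ⁻¹) ?_ ?_ ?_ ?_ ?_
  · intro σ hσ
    simp only [Finset.mem_filter, Finset.mem_univ, true_and] at hσ ⊢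
    intro i
    rw [← hσ, perm_apply_inv_apply]
  · intro σ hσ
    simp only [Finset.mem_filter, Finset.mem_univ, true_and] at hσ ⊢
    intro i
    rw [← hσ, perm_apply_inv_apply]
  · exact fun σ _ => inv_inv σ
  · exact fun σ _ => inv_inv σ
  · intro σ _
    rw [Finsupp.smul_apply, tabloidRep_single, Finsupp.single_apply, Equiv.Perm.sign_inv,
      smul_eq_mul]
    simp only [funext_iff]

theorem exists_perm_of_polytabloid_apply_ne_zero {t : Fin n ≃ {c // c ∈ μ.cells}} {r : Fin n → ℕ}
    (h : polytabloid t r ≠ 0) :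
    ∃ τ : Equiv.Perm (Fin n), (∀ i, (t (τ i)).1.2 = (t i).1.2) ∧ ∀ i, (t (τ i)).1.1 = r i := by
  rw [polytabloid_apply] at h
  obtain ⟨σ, hσ, hne⟩ := Finset.exists_ne_zero_of_sum_ne_zero h
  refine ⟨σ, (Finset.mem_filter.1 hσ).2, ?_⟩
  by_contra h1
  exact hne (by rw [if_neg h1, mul_zero])

theorem polytabloid_ne_zero (t : Fin n ≃ {c // c ∈ μ.cells}) : polytabloid t ≠ 0 := by
  intro h
  have h1 : polytabloid t (fun i => (t i).1.1) = 1 := by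
    rw [polytabloid_apply, Finset.sum_eq_single 1]
    · simp
    · intro σ hσ hne
      rw [if_neg, mul_zero]
      intro h2
      refine hne (Equiv.ext fun i => t.injective (Subtype.ext (Prod.ext (h2 i) ?_)))
      exact (Finset.mem_filter.1 hσ).2 i
    · intro hn
      exact absurd (Finset.mem_filter.2 ⟨Finset.mem_univ _, fun i => rfl⟩) hn
  rw [h] at h1
  exact zero_ne_one h1

theorem polytabloid_mem_spechtModule (t : Fin n ≃ {c // c ∈ μ.cells}) :
    polytabloid t ∈ (spechtModule n μ).toSubmodule :=
  Submodule.subset_span ⟨t, rfl⟩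

/-- Every tabloid in the support of a vector of the Specht module has shape `μ`. -/
theorem exists_filling_of_mem_spechtModule {v : (Fin n → ℕ) →₀ ℂ}
    (hv : v ∈ (spechtModule n μ).toSubmodule) (r : Fin n → ℕ) (hr : v r ≠ 0) :
    ∃ τ : Fin n ≃ {c // c ∈ μ.cells}, ∀ i, (τ i).1.1 = r i := by
  have hv' : v ∈ Submodule.span ℂ
    (Set.range fun t : Fin n ≃ {c // c ∈ μ.cells} => polytabloid t) := hv
  induction hv' using Submodule.span_induction with
  | mem x hx =>
    obtain ⟨t', rfl⟩ := hx
    obtain ⟨τ, -, h⟩ := exists_perm_of_polytabloid_apply_ne_zero hr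
    exact ⟨τ.trans t', h⟩
  | zero => exact absurd rfl hr
  | add x y hx hy ihx ihy =>
    by_cases h : x r = 0
    · rw [Finsupp.add_apply, h, zero_add] at hr
      exact ihy hy hr
    · exact ihx hx h
  | smul a x hx ih =>
    rw [Finsupp.smul_apply] at hr
    exact ih hx (right_ne_zero_of_smul hr)

end ColumnAntisymmetrizer

/-! ### Irreducibility of Specht modules -/

section Irreducible

theorem Subrepresentation.isIrreducible_toRepresentation {k G V : Type*} [Field k] [Group G]
    [AddCommGroup V] [Module k V] {ρ : Representation k G V} (P : Subrepresentation ρ)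
    (h0 : P.toSubmodule ≠ ⊥)
    (h : ∀ Q : Subrepresentation ρ, Q.toSubmodule ≤ P.toSubmodule →
      Q.toSubmodule = ⊥ ∨ P.toSubmodule ≤ Q.toSubmodule) :
    P.toRepresentation.IsIrreducible := by
  have hnt : Nontrivial (Subrepresentation P.toRepresentation) := by
    refine ⟨⊥, ⊤, fun h1 => h0 ((Submodule.eq_bot_iff _).2 fun v hv => ?_)⟩
    have h2 : (⟨v, hv⟩ : P.toSubmodule) ∈ (⊥ : Submodule k P.toSubmodule) := by
      have h3 : (⊥ : Submodule k P.toSubmodule) = ⊤ :=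
        congrArg Subrepresentation.toSubmodule h1
      rw [h3]
      exact Submodule.mem_top
    exact congrArg Subtype.val ((Submodule.mem_bot k).1 h2)
  refine ⟨fun U => ?_⟩
  let Q : Subrepresentation ρ :=
    { toSubmodule := U.toSubmodule.map P.toSubmodule.subtype
      apply_mem_toSubmodule := by
        rintro g _ ⟨v, hv, rfl⟩
        exact ⟨P.toRepresentation g v, U.apply_mem_toSubmodule g hv, rfl⟩ }
  rcases h Q (Submodule.map_subtype_le _ _) with h1 | h1
  · left
    refine Subrepresentation.toSubmodule_injective ?_
    refine (Submodule.eq_bot_iff _).2 fun v hv => Subtype.ext ?_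
    exact (Submodule.eq_bot_iff _).1 h1 v ⟨v, hv, rfl⟩
  · right
    refine Subrepresentation.toSubmodule_injective (Submodule.eq_top_iff'.2 fun v => ?_)
    obtain ⟨w, hw, he⟩ := h1 v.2
    rwa [← Subtype.ext he]

variable {n : ℕ} {μ : YoungDiagram}

/-- The Specht module is stable under complex conjugation, as polytabloids have real
coefficients. -/
theorem mapRange_conj_mem_spechtModule {v : (Fin n → ℕ) →₀ ℂ}
    (hv : v ∈ (spechtModule n μ).toSubmodule) :
    v.mapRange (starRingEnd ℂ) (map_zero _) ∈ (spechtModule n μ).toSubmodule := by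
  have hv' : v ∈ Submodule.span ℂ
    (Set.range fun t : Fin n ≃ {c // c ∈ μ.cells} => polytabloid t) := hv
  induction hv' using Submodule.span_induction with
  | mem x hx =>
    obtain ⟨t, rfl⟩ := hx
    have h1 : (polytabloid t).mapRange (starRingEnd ℂ) (map_zero _) = polytabloid t := by
      ext r
      rw [Finsupp.mapRange_apply, polytabloid_apply, map_sum]
      refine Finset.sum_congr rfl fun σ _ => ?_
      rw [map_mul]
      split_ifs <;> simp
    simp only [h1]
    exact polytabloid_mem_spechtModule t
  | zero => simp
  | add x y hx hy ihx ihy =>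
    rw [Finsupp.mapRange_add (map_add (starRingEnd ℂ))]
    exact Submodule.add_mem _ (ihx hx) (ihy hy)
  | smul a x hx ih =>
    have h1 : (a • x).mapRange (starRingEnd ℂ) (map_zero _) =
        starRingEnd ℂ a • x.mapRange (starRingEnd ℂ) (map_zero _) := by
      ext r
      simp
    rw [h1]
    exact Submodule.smul_mem _ _ (ih hx)

/-- A vector of the Specht module killed by all column antisymmetrizers is orthogonal to all
polytabloids, hence to its own complex conjugate. -/
theorem eq_zero_of_colAntisymmetrizer_eq_zero {v : (Fin n → ℕ) →₀ ℂ}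
    (hv : v ∈ (spechtModule n μ).toSubmodule)
    (h : ∀ t : Fin n ≃ {c // c ∈ μ.cells}, colAntisymmetrizer (fun i => (t i).1.2) v = 0) :
    v = 0 := by
  have h1 : ∀ w ∈ (spechtModule n μ).toSubmodule,
      Finsupp.linearCombination ℂ (v : (Fin n → ℕ) → ℂ) w = 0 := by
    intro w hw
    have hle : (spechtModule n μ).toSubmodule ≤
        LinearMap.ker (Finsupp.linearCombination ℂ (v : (Fin n → ℕ) → ℂ)) := by
      refine Submodule.span_le.2 ?_
      rintro _ ⟨t, rfl⟩
      have h2 := DFunLike.congr_fun (h t) fun i => (t i).1.1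
      rw [colAntisymmetrizer_apply, Finsupp.finsetSum_apply] at h2
      change Finsupp.linearCombination ℂ (v : (Fin n → ℕ) → ℂ) (polytabloid t) = 0
      rw [polytabloid, map_sum, ← Finsupp.zero_apply (a := fun i => (t i).1.1), ← h2]
      refine Finset.sum_bij' (fun σ _ => σ⁻¹) (fun σ _ => σ⁻¹) ?_ ?_ ?_ ?_ ?_
      · intro σ hσ
        simp only [Finset.mem_filter, Finset.mem_univ, true_and] at hσ ⊢
        intro i
        rw [← hσ, perm_apply_inv_apply]
      · intro σ hσ
        simp only [Finset.mem_filter, Finset.mem_univ, true_and] at hσ ⊢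
        intro i
        rw [← hσ, perm_apply_inv_apply]
      · exact fun σ _ => inv_inv σ
      · exact fun σ _ => inv_inv σ
      · intro σ _
        rw [map_smul, tabloidRep_single, Finsupp.linearCombination_single, one_smul,
          Finsupp.smul_apply, tabloidRep_apply_apply, Equiv.Perm.sign_inv]
    exact hle hw
  have h2 := h1 _ (mapRange_conj_mem_spechtModule hv)
  rw [Finsupp.linearCombination_apply, Finsupp.sum_mapRange_index (fun _ => by rw [zero_smul]),
    Finsupp.sum] at h2
  have h3 : ∑ r ∈ v.support, Complex.normSq (v r) = 0 := by
    have : ((∑ r ∈ v.support, Complex.normSq (v r) : ℝ) : ℂ) = 0 := by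
      rw [← h2, Complex.ofReal_sum]
      refine Finset.sum_congr rfl fun r _ => ?_
      rw [Complex.normSq_eq_conj_mul_self, smul_eq_mul]
    exact_mod_cast this
  rw [Finset.sum_eq_zero_iff_of_nonneg fun r _ => Complex.normSq_nonneg _] at h3
  ext r
  by_contra hr
  exact hr (Complex.normSq_eq_zero.1 (h3 r (Finsupp.mem_support_iff.2 hr)))

theorem nonempty_filling (h : μ.card = n) : Nonempty (Fin n ≃ {c // c ∈ μ.cells}) :=
  ⟨Fintype.equivOfCardEq (by rw [Fintype.card_fin, Fintype.card_coe]; exact h.symm)⟩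

/-- James's submodule theorem: a subrepresentation of the Specht module on which some column
antisymmetrizer does not vanish contains a polytabloid, hence all of them. -/
theorem spechtRep_isIrreducible (h : μ.card = n) : (spechtRep n μ).IsIrreducible := by
  refine Subrepresentation.isIrreducible_toRepresentation (spechtModule n μ) ?_ ?_
  · intro h0
    obtain ⟨t⟩ := nonempty_filling h
    have h1 := polytabloid_mem_spechtModule t
    rw [h0] at h1
    exact polytabloid_ne_zero t ((Submodule.mem_bot ℂ).1 h1)
  · intro Q hQ
    by_cases hz : ∀ v ∈ Q.toSubmodule, ∀ t : Fin n ≃ {c // c ∈ μ.cells},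
        colAntisymmetrizer (fun i => (t i).1.2) v = 0
    · left
      exact (Submodule.eq_bot_iff _).2 fun v hv =>
        eq_zero_of_colAntisymmetrizer_eq_zero (hQ hv) (hz v hv)
    · right
      push Not at hz
      obtain ⟨v, hv, t, hne⟩ := hz
      have h1 : colAntisymmetrizer (fun i => (t i).1.2) v ∈ Q.toSubmodule := by
        rw [colAntisymmetrizer_apply]
        exact Submodule.sum_mem _ fun σ _ =>
          Submodule.smul_mem _ _ (Q.apply_mem_toSubmodule σ hv)
      obtain ⟨a, ha⟩ := Submodule.mem_span_singleton.1 (colAntisymmetrizer_mem_span t (v := v)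
        (fun r hr => by
          obtain ⟨τ, hτ⟩ := exists_filling_of_mem_spechtModule (hQ hv) r hr
          simp only [← hτ]
          rw [← Equiv.sum_comp (τ.trans t.symm) fun i => (t i).1.1]
          simp))
      rw [← ha] at h1 hne
      have h2 : polytabloid t ∈ Q.toSubmodule :=
        (Submodule.smul_mem_iff _ (left_ne_zero_of_smul hne)).1 h1
      refine Submodule.span_le.2 ?_
      rintro _ ⟨t', rfl⟩
      have h3 := Q.apply_mem_toSubmodule (t.trans t'.symm) h2
      rw [tabloidRep_polytabloid] at h3
      have h4 : (Equiv.trans (t.trans t'.symm : Equiv.Perm (Fin n))⁻¹ t :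
          Fin n ≃ {c // c ∈ μ.cells}) = t' := Equiv.ext fun i => by simp [Equiv.Perm.inv_def]
      rwa [h4] at h3

end Irreducible

/-! ### Restricting tabloids to the second elements of the pairs -/

section PairRestrict

variable {k : ℕ}

theorem exists_eq_pairEquiv (x : Fin (2 * k)) :
    ∃ i, x = pairEquiv k (i, 0) ∨ x = pairEquiv k (i, 1) := by
  obtain ⟨⟨i, j⟩, rfl⟩ := (pairEquiv k).surjective x
  refine ⟨i, ?_⟩
  rcases Fin.exists_fin_two.1 ⟨j, rfl⟩ with h | h
  · exact Or.inl (by rw [h])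
  · exact Or.inr (by rw [h])

theorem funext_pairEquiv {α : Type*} {f g : Fin (2 * k) → α}
    (h0 : ∀ i, f (pairEquiv k (i, 0)) = g (pairEquiv k (i, 0)))
    (h1 : ∀ i, f (pairEquiv k (i, 1)) = g (pairEquiv k (i, 1))) : f = g := by
  funext x
  obtain ⟨i, rfl | rfl⟩ := exists_eq_pairEquiv x
  · exact h0 i
  · exact h1 i

theorem sum_pairEquiv {M : Type*} [AddCommMonoid M] (f : Fin (2 * k) → M) :
    ∑ x, f x = ∑ i, (f (pairEquiv k (i, 0)) + f (pairEquiv k (i, 1))) := by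
  rw [← Equiv.sum_comp (pairEquiv k), Fintype.sum_prod_type]
  simp only [Fin.sum_univ_two]

/-- The row assignment of `Fin (2 k)` that puts the first elements of all pairs into row `0`, and
the second element of pair `i` into the row below row `r i`. -/
def pairLift (k : ℕ) (r : Fin k → ℕ) (x : Fin (2 * k)) : ℕ :=
  if ((pairEquiv k).symm x).2 = 0 then 0 else r ((pairEquiv k).symm x).1 + 1

theorem pairLift_zero (r : Fin k → ℕ) (i : Fin k) : pairLift k r (pairEquiv k (i, 0)) = 0 := by
  simp [pairLift]

theorem pairLift_one (r : Fin k → ℕ) (i : Fin k) :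
    pairLift k r (pairEquiv k (i, 1)) = r i + 1 := by
  simp [pairLift]

theorem pairLift_injective (k : ℕ) : Function.Injective (pairLift k) := by
  intro r r' h
  funext i
  have h1 := congrFun h (pairEquiv k (i, 1))
  rw [pairLift_one, pairLift_one] at h1
  exact Nat.succ_injective h1

/-- The linear map that keeps the tabloids with the first elements of all pairs in row `0` and
the second elements below, restricted to the second elements, and kills all others. -/
noncomputable def pairRestrict (k : ℕ) :
    ((Fin (2 * k) → ℕ) →₀ ℂ) →ₗ[ℂ] ((Fin k → ℕ) →₀ ℂ) :=
  Finsupp.lcomapDomain (pairLift k) (pairLift_injective k)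

theorem pairRestrict_apply (v : (Fin (2 * k) → ℕ) →₀ ℂ) (r : Fin k → ℕ) :
    pairRestrict k v r = v (pairLift k r) := rfl

theorem pairRestrict_psi (σ : Equiv.Perm (Fin k)) (v : (Fin (2 * k) → ℕ) →₀ ℂ) :
    pairRestrict k (tabloidRep (2 * k) (psi k σ) v) = tabloidRep k σ (pairRestrict k v) := by
  ext r
  rw [pairRestrict_apply, tabloidRep_apply_apply, tabloidRep_apply_apply, pairRestrict_apply]
  congr 1
  refine funext_pairEquiv (fun i => ?_) fun i => ?_
  · rw [psi_pairEquiv, pairLift_zero, pairLift_zero]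
  · rw [psi_pairEquiv, pairLift_one, pairLift_one]

/-- The second elements of the pairs. -/
def secondEquiv (k : ℕ) : Fin k ≃ {x : Fin (2 * k) // ((pairEquiv k).symm x).2 = 1} where
  toFun i := ⟨pairEquiv k (i, 1), by simp⟩
  invFun x := ((pairEquiv k).symm x.1).1
  left_inv i := by simp
  right_inv x := Subtype.ext (by
    have h : (((pairEquiv k).symm x.1).1, (1 : Fin 2)) = (pairEquiv k).symm x.1 :=
      Prod.ext rfl x.2.symm
    simp only [h, Equiv.apply_symm_apply])

/-- A permutation of the pairs, acting on their second elements only. -/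
def secondPerm (k : ℕ) (π : Equiv.Perm (Fin k)) : Equiv.Perm (Fin (2 * k)) :=
  π.extendDomain (secondEquiv k)

theorem secondPerm_zero (π : Equiv.Perm (Fin k)) (i : Fin k) :
    secondPerm k π (pairEquiv k (i, 0)) = pairEquiv k (i, 0) :=
  Equiv.Perm.extendDomain_apply_not_subtype _ _ (by simp)

theorem secondPerm_one (π : Equiv.Perm (Fin k)) (i : Fin k) :
    secondPerm k π (pairEquiv k (i, 1)) = pairEquiv k (π i, 1) :=
  Equiv.Perm.extendDomain_apply_image π (secondEquiv k) i

theorem pairRestrict_secondPerm (π : Equiv.Perm (Fin k)) (v : (Fin (2 * k) → ℕ) →₀ ℂ) :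
    pairRestrict k (tabloidRep (2 * k) (secondPerm k π) v) =
      tabloidRep k π (pairRestrict k v) := by
  ext r
  rw [pairRestrict_apply, tabloidRep_apply_apply, tabloidRep_apply_apply, pairRestrict_apply]
  congr 1
  refine funext_pairEquiv (fun i => ?_) fun i => ?_
  · rw [secondPerm_zero, pairLift_zero, pairLift_zero]
  · rw [secondPerm_one, pairLift_one, pairLift_one]

variable {lam : YoungDiagram}

/-- If the first row of a filling `t` of `(k, lam)` consists of the first elements of the pairs,
then the second elements fill `lam`. -/
theorem exists_restricted_filling (hlam : lam.card = k)
    (t : Fin (2 * k) ≃ {c // c ∈ (YoungDiagram.consRow k lam).cells}) (r : Fin k → ℕ)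
    (hr : ∀ x, (t x).1.1 = pairLift k r x) :
    ∃ u : Fin k ≃ {c // c ∈ lam.cells},
      ∀ i, (u i).1 = (r i, (t (pairEquiv k (i, 1))).1.2) := by
  have hmem : ∀ i, (r i, (t (pairEquiv k (i, 1))).1.2) ∈ lam.cells := by
    intro i
    have h1 := (YoungDiagram.mem_cells _).1 (t (pairEquiv k (i, 1))).2
    have h2 : (t (pairEquiv k (i, 1))).1 = (r i + 1, (t (pairEquiv k (i, 1))).1.2) :=
      Prod.ext ((hr _).trans (pairLift_one r i)) rfl
    rw [h2] at h1
    exact (YoungDiagram.mem_cells _).2 (YoungDiagram.mem_consRow_succ.1 h1).2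
  have hinj : Function.Injective
      fun i => (⟨(r i, (t (pairEquiv k (i, 1))).1.2), hmem i⟩ : {c // c ∈ lam.cells}) := by
    intro i j h
    have h1 := Prod.ext_iff.1 (Subtype.ext_iff.1 h)
    have h2 : t (pairEquiv k (i, 1)) = t (pairEquiv k (j, 1)) := by
      refine Subtype.ext (Prod.ext ?_ h1.2)
      rw [hr, hr, pairLift_one, pairLift_one]
      exact congrArg Nat.succ h1.1
    exact (Prod.ext_iff.1 ((pairEquiv k).injective (t.injective h2))).1
  refine ⟨Equiv.ofBijective _ ((Fintype.bijective_iff_injective_and_card _).2 ⟨hinj, ?_⟩),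
    fun i => rfl⟩
  rw [Fintype.card_fin, Fintype.card_coe]
  exact hlam.symm

/-- The restriction of a polytabloid is antisymmetric under the column permutations of the second
elements, so it is proportional to its column antisymmetrization, which is in the Specht module. -/
theorem pairRestrict_polytabloid_mem (hlam : lam.card = k)
    (t : Fin (2 * k) ≃ {c // c ∈ (YoungDiagram.consRow k lam).cells}) :
    pairRestrict k (polytabloid t) ∈ (spechtModule k lam).toSubmodule := by
  by_cases hz : pairRestrict k (polytabloid t) = 0
  · rw [hz]
    exact Submodule.zero_mem _
  obtain ⟨r₀, hr₀⟩ := Finsupp.ne_iff.1 hz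
  obtain ⟨τ, hτcol, hτrow⟩ := exists_perm_of_polytabloid_apply_ne_zero
    (show polytabloid t (pairLift k r₀) ≠ 0 from hr₀)
  obtain ⟨u, hu⟩ := exists_restricted_filling hlam (τ.trans t) r₀ hτrow
  have hcol : ∀ i, (u i).1.2 = (t (pairEquiv k (i, 1))).1.2 := fun i => by
    rw [hu]
    exact hτcol _
  have hrow : ∀ i, (u i).1.1 = r₀ i := fun i => by rw [hu]
  have hanti : ∀ π : Equiv.Perm (Fin k), (∀ i, (u (π i)).1.2 = (u i).1.2) →
      tabloidRep k π (pairRestrict k (polytabloid t)) =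
        ((Equiv.Perm.sign π : ℤ) : ℂ) • pairRestrict k (polytabloid t) := by
    intro π hπ
    have h1 : ∀ x, (t (secondPerm k π x)).1.2 = (t x).1.2 := by
      intro x
      obtain ⟨i, rfl | rfl⟩ := exists_eq_pairEquiv x
      · rw [secondPerm_zero]
      · rw [secondPerm_one, ← hcol, hπ, hcol]
    rw [← pairRestrict_secondPerm, polytabloid_eq, tabloidRep_colAntisymmetrizer h1, map_smul,
      secondPerm, Equiv.Perm.sign_extendDomain]
  have hsum : ∀ r, pairRestrict k (polytabloid t) r ≠ 0 → ∑ i, r i = ∑ i, (u i).1.1 := by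
    intro r hr
    obtain ⟨τ', -, hτ'⟩ := exists_perm_of_polytabloid_apply_ne_zero
      (show polytabloid t (pairLift k r) ≠ 0 from hr)
    have h1 : ∑ x, pairLift k r x = ∑ x, pairLift k r₀ x := by
      simp only [← hτ', ← hτrow]
      rw [Equiv.sum_comp τ' fun x => (t x).1.1, Equiv.sum_comp τ fun x => (t x).1.1]
    rw [sum_pairEquiv, sum_pairEquiv] at h1
    simp only [pairLift_zero, pairLift_one, zero_add, Finset.sum_add_distrib,
      add_left_inj] at h1
    rw [h1]
    exact Finset.sum_congr rfl fun i _ => (hrow i).symm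
  have hspan := colAntisymmetrizer_mem_span u hsum
  have hle : Submodule.span ℂ {polytabloid u} ≤ (spechtModule k lam).toSubmodule := by
    rw [Submodule.span_singleton_le_iff_mem]
    exact polytabloid_mem_spechtModule u
  have h2 := hle hspan
  rw [colAntisymmetrizer_apply, Finset.sum_congr rfl fun π hπ => by
    rw [hanti π (Finset.mem_filter.1 hπ).2, smul_smul, sign_mul_sign_self, one_smul],
    Finset.sum_const, ← Nat.cast_smul_eq_nsmul ℂ] at h2
  refine (Submodule.smul_mem_iff _ ?_).1 h2
  rw [Nat.cast_ne_zero]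
  exact Finset.card_ne_zero.2 ⟨1, Finset.mem_filter.2 ⟨Finset.mem_univ _, fun i => rfl⟩⟩

theorem pairRestrict_mem_spechtModule (hlam : lam.card = k) {v : (Fin (2 * k) → ℕ) →₀ ℂ}
    (hv : v ∈ (spechtModule (2 * k) (YoungDiagram.consRow k lam)).toSubmodule) :
    pairRestrict k v ∈ (spechtModule k lam).toSubmodule := by
  have hle : (spechtModule (2 * k) (YoungDiagram.consRow k lam)).toSubmodule ≤
      (spechtModule k lam).toSubmodule.comap (pairRestrict k) := by
    refine Submodule.span_le.2 ?_
    rintro _ ⟨t, rfl⟩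
    exact pairRestrict_polytabloid_mem hlam t
  exact hle hv

theorem tabloidRep_pairSwap_apply (i : Fin k) (v : (Fin (2 * k) → ℕ) →₀ ℂ)
    (r : Fin (2 * k) → ℕ) :
    tabloidRep (2 * k) (pairSwap k i) v r = v fun x => r (pairSwap k i x) :=
  tabloidRep_apply_apply _ _ _

/-- In the tabloids of shape `(k, lam)`, row `0` has `k` elements. -/
theorem card_row_zero_of_mem_spechtModule {v : (Fin (2 * k) → ℕ) →₀ ℂ}
    (hv : v ∈ (spechtModule (2 * k) (YoungDiagram.consRow k lam)).toSubmodule)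
    {r : Fin (2 * k) → ℕ} (hr : v r ≠ 0) : ∑ x, (if r x = 0 then 1 else 0) = k := by
  obtain ⟨t, ht⟩ := exists_filling_of_mem_spechtModule hv r hr
  simp only [← ht]
  rw [Equiv.sum_comp t fun c => if c.1.1 = 0 then 1 else 0,
    Finset.sum_coe_sort (YoungDiagram.consRow k lam).cells fun c => if c.1 = 0 then 1 else 0,
    ← Finset.card_filter]
  exact (YoungDiagram.rowLen_eq_card _).symm.trans (YoungDiagram.rowLen_consRow_zero k lam)

/-- A vector on which all transpositions of pairs act by `-1` is determined by its restriction. In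
the tabloids of its support no pair lies in one row, so each pair has exactly one element in row
`0`, and up to transpositions this is the first one. -/
theorem eq_zero_of_pairRestrict_eq_zero {v : (Fin (2 * k) → ℕ) →₀ ℂ}
    (hv : v ∈ (spechtModule (2 * k) (YoungDiagram.consRow k lam)).toSubmodule)
    (hsign : ∀ i, tabloidRep (2 * k) (pairSwap k i) v = -v) (h0 : pairRestrict k v = 0) :
    v = 0 := by
  by_contra hne
  -- Minimizing the row indices of the first elements puts them into row `0`: otherwise the
  -- transposition of a pair would decrease the sum.
  obtain ⟨r, hr, hmin⟩ := Finset.exists_min_image v.support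
    (fun r => ∑ i, r (pairEquiv k (i, 0))) (Finsupp.support_nonempty_iff.2 hne)
  rw [Finsupp.mem_support_iff] at hr
  have hswap : ∀ i, v (fun x => r (pairSwap k i x)) = -v r := fun i => by
    rw [← tabloidRep_pairSwap_apply, hsign, Finsupp.neg_apply]
  have hdiff : ∀ i, r (pairEquiv k (i, 0)) ≠ r (pairEquiv k (i, 1)) := by
    intro i h
    have h1 : (fun x => r (pairSwap k i x)) = r := by
      funext x
      rw [pairSwap, Equiv.swap_apply_def]
      split_ifs with h2 h2
      · rw [h2, h]
      · rw [h2, h]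
      · rfl
    have h2 := hswap i
    rw [h1, self_eq_neg] at h2
    exact hr h2
  have hcount := card_row_zero_of_mem_spechtModule hv hr
  rw [sum_pairEquiv] at hcount
  have hle : ∀ i ∈ (Finset.univ : Finset (Fin k)), ((if r (pairEquiv k (i, 0)) = 0 then 1 else 0) +
      if r (pairEquiv k (i, 1)) = 0 then 1 else 0) ≤ 1 := by
    intro i _
    have := hdiff i
    split_ifs <;> omega
  have hone : ∀ i, ((if r (pairEquiv k (i, 0)) = 0 then 1 else 0) +
      if r (pairEquiv k (i, 1)) = 0 then 1 else 0) = 1 := by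
    have h1 : ∑ i : Fin k, ((if r (pairEquiv k (i, 0)) = 0 then 1 else 0) +
      if r (pairEquiv k (i, 1)) = 0 then 1 else 0) = ∑ i : Fin k, 1 := by simpa using hcount
    exact fun i => (Finset.sum_eq_sum_iff_of_le hle).1 h1 i (Finset.mem_univ i)
  have hfirst : ∀ i, r (pairEquiv k (i, 0)) = 0 := by
    intro i
    by_contra hi
    have hi1 : r (pairEquiv k (i, 1)) = 0 := by
      have := hone i
      rw [if_neg hi] at this
      by_contra h1
      rw [if_neg h1] at this
      omega
    have h1 := hmin (fun x => r (pairSwap k i x)) (by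
      rw [Finsupp.mem_support_iff, hswap, neg_ne_zero]
      exact hr)
    refine absurd h1 (not_le.2 (Finset.sum_lt_sum (fun j _ => ?_) ⟨i, Finset.mem_univ i, ?_⟩))
    · by_cases hj : j = i
      · subst hj
        rw [pairSwap, Equiv.swap_apply_left, hi1]
        exact Nat.zero_le _
      · rw [pairSwap, Equiv.swap_apply_of_ne_of_ne]
        · simpa using hj
        · simp
    · rw [pairSwap, Equiv.swap_apply_left, hi1]
      exact Nat.pos_of_ne_zero hi
  have hlift : r = pairLift k fun i => r (pairEquiv k (i, 1)) - 1 := by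
    refine funext_pairEquiv (fun i => ?_) fun i => ?_
    · rw [pairLift_zero, hfirst]
    · rw [pairLift_one]
      have := hdiff i
      rw [hfirst] at this
      omega
  refine hr ?_
  rw [hlift, ← pairRestrict_apply, h0]
  rfl

end PairRestrict

/-! ### A vector on which the pair transpositions act by the sign -/

section SignVector

variable {k : ℕ}

theorem pairSwapGroup_fst {δ : Equiv.Perm (Fin (2 * k))} (hδ : δ ∈ pairSwapGroup k)
    (p : Fin k × Fin 2) : ((pairEquiv k).symm (δ (pairEquiv k p))).1 = p.1 := by
  have h1 : δ ∈ hyperoctahedral k := Subgroup.closure_mono Set.subset_union_right hδ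
  have h2 := blockPerm_eq ⟨δ, h1⟩ 1 δ hδ (by rw [map_one, one_mul])
  obtain ⟨σ, hσ⟩ := hyperoctahedral_blocks δ h1
  rw [hσ, ← hσ (p.1, 0)]
  exact DFunLike.congr_fun h2 p.1

theorem pairSwapGroup_eq_or {δ : Equiv.Perm (Fin (2 * k))} (hδ : δ ∈ pairSwapGroup k)
    (i : Fin k) (j : Fin 2) :
    δ (pairEquiv k (i, j)) = pairEquiv k (i, 0) ∨ δ (pairEquiv k (i, j)) = pairEquiv k (i, 1) := by
  have h1 := pairSwapGroup_fst hδ (i, j)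
  obtain ⟨i', h | h⟩ := exists_eq_pairEquiv (δ (pairEquiv k (i, j)))
  · rw [h, Equiv.symm_apply_apply] at h1
    rw [h]
    exact Or.inl (congrArg (fun a => pairEquiv k (a, 0)) h1)
  · rw [h, Equiv.symm_apply_apply] at h1
    rw [h]
    exact Or.inr (congrArg (fun a => pairEquiv k (a, 1)) h1)

variable {lam : YoungDiagram}

/-- The cells of `lam` are matched with the columns of a first row of length `|lam|`, so that a
cell in the first row of `lam` is matched with its own column. -/
theorem exists_column_matching (hlam : lam.card = k) (u : Fin k ≃ {c // c ∈ lam.cells}) :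
    ∃ b : Fin k → ℕ, Function.Injective b ∧ (∀ i, b i < k) ∧
      ∀ i, (u i).1.1 = 0 → b i = (u i).1.2 := by
  classical
  have hlt : ∀ i, (u i).1.2 < k := fun i => by
    have h1 := YoungDiagram.mem_iff_lt_rowLen.1 ((YoungDiagram.mem_cells _).1 (u i).2)
    have h2 := lam.rowLen_anti 0 (u i).1.1 (Nat.zero_le _)
    exact h1.trans_le (h2.trans (lam.rowLen_zero_le_card.trans hlam.le))
  obtain ⟨g, hg⟩ := Finset.exists_equiv_extend_of_card_eq (α := Fin k) (t := Finset.range k)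
    (by rw [Fintype.card_fin, Finset.card_range])
    (s := Finset.univ.filter fun i => (u i).1.1 = 0) (f := fun i => (u i).1.2)
    (by
      intro c hc
      obtain ⟨i, -, rfl⟩ := Finset.mem_image.1 hc
      exact Finset.mem_range.2 (hlt i))
    (by
      intro i hi j hj h
      refine u.injective (Subtype.ext (Prod.ext ?_ h))
      rw [(Finset.mem_filter.1 hi).2, (Finset.mem_filter.1 hj).2])
  exact ⟨fun i => (g i).1, fun i j h => g.injective (Subtype.ext h),
    fun i => Finset.mem_range.1 (g i).2,
    fun i hi => hg i (Finset.mem_filter.2 ⟨Finset.mem_univ i, hi⟩)⟩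

/-- A filling of `lam` and an order of the first row combine to a filling of `(k, lam)`, in which
the first elements of the pairs form the first row. -/
theorem exists_pair_filling (hlam : lam.card = k) (u : Fin k ≃ {c // c ∈ lam.cells})
    {b : Fin k → ℕ} (hb : Function.Injective b) (hbk : ∀ i, b i < k) :
    ∃ t : Fin (2 * k) ≃ {c // c ∈ (YoungDiagram.consRow k lam).cells},
      (∀ i, (t (pairEquiv k (i, 0))).1 = (0, b i)) ∧
      ∀ i, (t (pairEquiv k (i, 1))).1 = ((u i).1.1 + 1, (u i).1.2) := by
  have hle : lam.rowLen 0 ≤ k := hlam ▸ lam.rowLen_zero_le_card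
  let f : Fin (2 * k) → ℕ × ℕ := fun x =>
    if ((pairEquiv k).symm x).2 = 0 then (0, b ((pairEquiv k).symm x).1)
    else ((u ((pairEquiv k).symm x).1).1.1 + 1, (u ((pairEquiv k).symm x).1).1.2)
  have f0 : ∀ i, f (pairEquiv k (i, 0)) = (0, b i) := fun i => by simp [f]
  have f1 : ∀ i, f (pairEquiv k (i, 1)) = ((u i).1.1 + 1, (u i).1.2) := fun i => by simp [f]
  have hf : ∀ x, f x ∈ (YoungDiagram.consRow k lam).cells := by
    intro x
    rw [YoungDiagram.mem_cells]
    obtain ⟨i, rfl | rfl⟩ := exists_eq_pairEquiv x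
    · rw [f0]
      exact YoungDiagram.mem_consRow_zero.2 (hbk i)
    · rw [f1]
      have h1 := (YoungDiagram.mem_cells _).1 (u i).2
      have h2 := YoungDiagram.mem_iff_lt_rowLen.1 h1
      have h3 := lam.rowLen_anti 0 (u i).1.1 (Nat.zero_le _)
      exact YoungDiagram.mem_consRow_succ.2 ⟨h2.trans_le (h3.trans hle), h1⟩
  have hinj : Function.Injective
      fun x => (⟨f x, hf x⟩ : {c // c ∈ (YoungDiagram.consRow k lam).cells}) := by
    intro x y h
    have h' : f x = f y := Subtype.ext_iff.1 h
    obtain ⟨i, rfl | rfl⟩ := exists_eq_pairEquiv x <;>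
    obtain ⟨j, rfl | rfl⟩ := exists_eq_pairEquiv y
    · rw [f0, f0, Prod.mk.injEq] at h'
      rw [hb h'.2]
    · rw [f0, f1, Prod.mk.injEq] at h'
      omega
    · rw [f0, f1, Prod.mk.injEq] at h'
      omega
    · rw [f1, f1, Prod.mk.injEq] at h'
      have : u i = u j := Subtype.ext (Prod.ext (Nat.succ_injective h'.1) h'.2)
      rw [u.injective this]
  refine ⟨Equiv.ofBijective _ ((Fintype.bijective_iff_injective_and_card _).2 ⟨hinj, ?_⟩), f0, f1⟩
  rw [Fintype.card_fin, Fintype.card_coe]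
  have := YoungDiagram.card_consRow hle
  rw [YoungDiagram.card] at this
  omega

/-- For a filling as in `exists_pair_filling`, a pair permutation and a column permutation that
agree on the rows of the filling are equal. -/
theorem eq_of_mem_pairSwapGroup (u : Fin k ≃ {c // c ∈ lam.cells}) {b : Fin k → ℕ}
    (hb : Function.Injective b) (hbu : ∀ i, (u i).1.1 = 0 → b i = (u i).1.2)
    {t : Fin (2 * k) ≃ {c // c ∈ (YoungDiagram.consRow k lam).cells}}
    (ht0 : ∀ i, (t (pairEquiv k (i, 0))).1 = (0, b i))
    (ht1 : ∀ i, (t (pairEquiv k (i, 1))).1 = ((u i).1.1 + 1, (u i).1.2))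
    {σ δ : Equiv.Perm (Fin (2 * k))} (hσ : ∀ x, (t (σ x)).1.2 = (t x).1.2)
    (hδ : δ ∈ pairSwapGroup k) (h : ∀ x, (t (σ x)).1.1 = (t (δ x)).1.1) : σ = δ := by
  suffices hcol : ∀ x, (t (δ x)).1.2 = (t x).1.2 from
    Equiv.ext fun x => t.injective (Subtype.ext (Prod.ext (h x) ((hσ x).trans (hcol x).symm)))
  -- If `u i` is not in the first row, then the column `b i` of the first element of pair `i` has
  -- length one, so that `σ`, and hence also `δ`, fixes this element.
  have hfix : ∀ i, (u i).1.1 ≠ 0 → δ (pairEquiv k (i, 0)) = pairEquiv k (i, 0) := by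
    intro i hi
    have hrow : (t (σ (pairEquiv k (i, 0)))).1.1 = 0 := by
      by_contra hne
      obtain ⟨j, hj | hj⟩ := exists_eq_pairEquiv (σ (pairEquiv k (i, 0)))
      · rw [hj, ht0] at hne
        exact hne rfl
      · have h1 := hσ (pairEquiv k (i, 0))
        rw [hj, ht1, ht0] at h1
        have h2 : (0, b i) ∈ lam.cells := by
          rw [YoungDiagram.mem_cells]
          refine lam.up_left_mem (Nat.zero_le _) h1.ge ((YoungDiagram.mem_cells _).1 (u j).2)
        have h3 : (u (u.symm ⟨(0, b i), h2⟩)).1 = (0, b i) := by rw [Equiv.apply_symm_apply]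
        have h4 := hbu (u.symm ⟨(0, b i), h2⟩) (by rw [h3])
        rw [h3] at h4
        rw [← hb h4, h3] at hi
        exact hi rfl
    rcases pairSwapGroup_eq_or hδ i 0 with h1 | h1
    · exact h1
    · rw [h, h1, ht1] at hrow
      exact absurd hrow (Nat.succ_ne_zero _)
  have hcols : ∀ i, (u i).1.1 = 0 →
      (t (pairEquiv k (i, 0))).1.2 = (t (pairEquiv k (i, 1))).1.2 := by
    intro i hi
    rw [ht0, ht1]
    exact hbu i hi
  intro x
  obtain ⟨i, hx⟩ := exists_eq_pairEquiv x
  by_cases hi : (u i).1.1 = 0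
  · rcases hx with rfl | rfl
    · rcases pairSwapGroup_eq_or hδ i 0 with h1 | h1 <;> rw [h1]
      exact (hcols i hi).symm
    · rcases pairSwapGroup_eq_or hδ i 1 with h1 | h1 <;> rw [h1]
      exact hcols i hi
  · rcases hx with rfl | rfl
    · rw [hfix i hi]
    · rcases pairSwapGroup_eq_or hδ i 1 with h1 | h1
      · have h2 := (pairEquiv k).injective (δ.injective (h1.trans (hfix i hi).symm))
        exact absurd (Prod.ext_iff.1 h2).2 (by simp)
      · rw [h1]

theorem pairSwap_mem (i : Fin k) : pairSwap k i ∈ pairSwapGroup k :=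
  Subgroup.subset_closure ⟨i, rfl⟩

theorem sign_pairSwap (i : Fin k) : Equiv.Perm.sign (pairSwap k i) = -1 :=
  Equiv.Perm.sign_swap (by simp)

/-- The antisymmetrization of a suitable polytabloid over the pair transpositions does not vanish:
all contributions to the coefficient of its own tabloid have the same sign. -/
theorem exists_sign_vector (hlam : lam.card = k) :
    ∃ v ∈ (spechtModule (2 * k) (YoungDiagram.consRow k lam)).toSubmodule,
      (∀ i, tabloidRep (2 * k) (pairSwap k i) v = -v) ∧ v ≠ 0 := by
  classical
  obtain ⟨u⟩ := nonempty_filling hlam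
  obtain ⟨b, hb, hbk, hbu⟩ := exists_column_matching hlam u
  obtain ⟨t, ht0, ht1⟩ := exists_pair_filling hlam u hb hbk
  let D : Finset (Equiv.Perm (Fin (2 * k))) := Finset.univ.filter (· ∈ pairSwapGroup k)
  have hD : ∀ {δ}, δ ∈ D ↔ δ ∈ pairSwapGroup k := by simp [D]
  refine ⟨∑ δ ∈ D, ((Equiv.Perm.sign δ : ℤ) : ℂ) • tabloidRep (2 * k) δ (polytabloid t), ?_, ?_, ?_⟩
  · exact Submodule.sum_mem _ fun δ _ => Submodule.smul_mem _ _
      ((spechtModule _ _).apply_mem_toSubmodule δ (polytabloid_mem_spechtModule t))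
  · intro i
    rw [map_sum, ← Finset.sum_neg_distrib]
    refine Finset.sum_bij' (fun δ _ => pairSwap k i * δ) (fun δ _ => (pairSwap k i)⁻¹ * δ)
      ?_ ?_ ?_ ?_ ?_
    · exact fun δ hδ => hD.2 (Subgroup.mul_mem _ (pairSwap_mem i) (hD.1 hδ))
    · exact fun δ hδ => hD.2
        (Subgroup.mul_mem _ (Subgroup.inv_mem _ (pairSwap_mem i)) (hD.1 hδ))
    · intro δ _
      group
    · intro δ _
      group
    · intro δ _
      rw [map_smul, ← neg_smul, map_mul, map_mul, sign_pairSwap]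
      simp
  · intro h
    have h1 := DFunLike.congr_fun h fun x => (t x).1.1
    rw [Finsupp.finsetSum_apply, Finsupp.zero_apply] at h1
    have h2 : ∀ δ ∈ D, (((Equiv.Perm.sign δ : ℤ) : ℂ) •
        tabloidRep (2 * k) δ (polytabloid t)) (fun x => (t x).1.1) =
        ((Finset.univ.filter fun σ : Equiv.Perm (Fin (2 * k)) =>
          (∀ x, (t (σ x)).1.2 = (t x).1.2) ∧ ∀ x, (t (σ x)).1.1 = (t (δ x)).1.1).card : ℂ) := by
      intro δ hδ
      rw [Finsupp.smul_apply, tabloidRep_apply_apply, polytabloid_apply, smul_eq_mul,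
        Finset.mul_sum, ← Finset.filter_filter, Finset.card_filter, Nat.cast_sum]
      refine Finset.sum_congr rfl fun σ hσ => ?_
      split_ifs with h3
      · rw [eq_of_mem_pairSwapGroup u hb hbu ht0 ht1 (Finset.mem_filter.1 hσ).2 (hD.1 hδ) h3,
          mul_one, sign_mul_sign_self, Nat.cast_one]
      · rw [mul_zero, mul_zero, Nat.cast_zero]
    rw [Finset.sum_congr rfl h2, ← Nat.cast_sum, Nat.cast_eq_zero, Finset.sum_eq_zero_iff] at h1
    have h3 := h1 1 (hD.2 (Subgroup.one_mem _))
    rw [Finset.card_eq_zero, Finset.filter_eq_empty_iff] at h3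
    exact h3 (Finset.mem_univ 1) ⟨fun _ => rfl, fun _ => rfl⟩

end SignVector

/-! ### Representations of the hyperoctahedral group -/

section Hyperoctahedral

variable {k : ℕ}

theorem psi_mem_hyperoctahedral (σ : Equiv.Perm (Fin k)) : psi k σ ∈ hyperoctahedral k :=
  Subgroup.subset_closure (Or.inl ⟨σ, rfl⟩)

theorem pairSwap_mem_hyperoctahedral (i : Fin k) : pairSwap k i ∈ hyperoctahedral k :=
  Subgroup.subset_closure (Or.inr ⟨i, rfl⟩)

theorem blockPerm_psi (σ : Equiv.Perm (Fin k)) :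
    blockPerm k ⟨psi k σ, psi_mem_hyperoctahedral σ⟩ = σ :=
  blockPerm_eq _ σ 1 (Subgroup.one_mem _) (by rw [mul_one])

theorem blockPerm_pairSwap (i : Fin k) :
    blockPerm k ⟨pairSwap k i, pairSwap_mem_hyperoctahedral i⟩ = 1 :=
  blockPerm_eq _ 1 (pairSwap k i) (pairSwap_mem i) (by rw [map_one, one_mul])

theorem deltaSign_apply (h : hyperoctahedral k) :
    deltaSign k h = (Equiv.Perm.sign (psi k (blockPerm k h)))⁻¹ * Equiv.Perm.sign h.1 := rfl

theorem deltaSign_psi (σ : Equiv.Perm (Fin k)) :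
    deltaSign k ⟨psi k σ, psi_mem_hyperoctahedral σ⟩ = 1 := by
  rw [deltaSign_apply, blockPerm_psi, inv_mul_cancel]

theorem deltaSign_pairSwap (i : Fin k) :
    deltaSign k ⟨pairSwap k i, pairSwap_mem_hyperoctahedral i⟩ = -1 := by
  rw [deltaSign_apply, blockPerm_pairSwap, map_one, map_one, inv_one, one_mul, sign_pairSwap]

theorem hyperoctahedralRep_apply (lam : YoungDiagram) (h : hyperoctahedral k)
    (v : SpechtSpace k lam) : hyperoctahedralRep k lam h v =
      ((deltaSign k h : ℤ) : ℂ) • spechtRep k lam (blockPerm k h) v := rfl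

theorem hyperoctahedralRep_psi (lam : YoungDiagram) (σ : Equiv.Perm (Fin k)) :
    hyperoctahedralRep k lam ⟨psi k σ, psi_mem_hyperoctahedral σ⟩ = spechtRep k lam σ := by
  ext1 v
  rw [hyperoctahedralRep_apply, deltaSign_psi, blockPerm_psi, Units.val_one, Int.cast_one,
    one_smul]

theorem hyperoctahedralRep_pairSwap (lam : YoungDiagram) (i : Fin k) (v : SpechtSpace k lam) :
    hyperoctahedralRep k lam ⟨pairSwap k i, pairSwap_mem_hyperoctahedral i⟩ v = -v := by
  rw [hyperoctahedralRep_apply, deltaSign_pairSwap, blockPerm_pairSwap, map_one]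
  simp

theorem hyperoctahedralRep_isIrreducible {lam : YoungDiagram} (hlam : lam.card = k) :
    (hyperoctahedralRep k lam).IsIrreducible := by
  have hirr := spechtRep_isIrreducible hlam
  have hnt := hirr.toNontrivial
  refine { exists_pair_ne := ?_, eq_bot_or_eq_top := fun U => ?_ }
  · refine ⟨⊥, ⊤, fun h => bot_ne_top (α := Subrepresentation (spechtRep k lam)) ?_⟩
    exact Subrepresentation.toSubmodule_injective
      (congrArg Subrepresentation.toSubmodule h : (⊥ : Submodule ℂ (SpechtSpace k lam)) = ⊤)
  · let U' : Subrepresentation (spechtRep k lam) :=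
      { toSubmodule := U.toSubmodule
        apply_mem_toSubmodule := fun σ v hv => by
          rw [← hyperoctahedralRep_psi]
          exact U.apply_mem_toSubmodule _ hv }
    rcases hirr.eq_bot_or_eq_top U' with h | h
    · exact Or.inl (Subrepresentation.toSubmodule_injective
        (congrArg Subrepresentation.toSubmodule h : U.toSubmodule = ⊥))
    · exact Or.inr (Subrepresentation.toSubmodule_injective
        (congrArg Subrepresentation.toSubmodule h : U.toSubmodule = ⊤))

theorem mem_signIsotypic_iff {V : Type*} [AddCommGroup V] [Module ℂ V]
    (ρ : Representation ℂ (Equiv.Perm (Fin (2 * k))) V) (v : V) :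
    v ∈ signIsotypic k ρ ↔ ∀ i, ρ (pairSwap k i) v = -v := by
  constructor
  · intro h i
    rw [h _ (pairSwap_mem i), sign_pairSwap]
    simp
  · intro h δ hδ
    induction hδ using Subgroup.closure_induction with
    | mem x hx =>
      obtain ⟨i, rfl⟩ := hx
      rw [h, sign_pairSwap]
      simp
    | one => simp
    | mul x y _ _ hx hy =>
      rw [map_mul, Module.End.mul_apply, hy, map_smul, hx, smul_smul, map_mul, Units.val_mul,
        Int.cast_mul, mul_comm]
    | inv x _ hx =>
      have h1 := congrArg (ρ x⁻¹) hx
      rw [← Module.End.mul_apply, ← map_mul, inv_mul_cancel, map_one, Module.End.one_apply,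
        map_smul] at h1
      rw [Equiv.Perm.sign_inv]
      conv_rhs => rw [h1, smul_smul, sign_mul_sign_self, one_smul]

theorem psi_mul_pairSwap (σ : Equiv.Perm (Fin k)) (i : Fin k) :
    pairSwap k (σ i) * psi k σ = psi k σ * pairSwap k i := by
  have h := Equiv.swap_apply_apply (psi k σ) (pairEquiv k (i, 0)) (pairEquiv k (i, 1))
  rw [psi_pairEquiv, psi_pairEquiv] at h
  rw [pairSwap, h, inv_mul_cancel_right, pairSwap]

/-- The sign-isotypic part of the pair transpositions is stable under the hyperoctahedral group. -/
theorem apply_mem_signIsotypic_iff {V : Type*} [AddCommGroup V] [Module ℂ V]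
    (ρ : Representation ℂ (Equiv.Perm (Fin (2 * k))) V) (h : Equiv.Perm (Fin (2 * k)))
    (hh : h ∈ hyperoctahedral k) (v : V) : ρ h v ∈ signIsotypic k ρ ↔ v ∈ signIsotypic k ρ := by
  induction hh using Subgroup.closure_induction generalizing v with
  | mem x hx =>
    have key : ∀ (σ : Equiv.Perm (Fin k)) (w : V), w ∈ signIsotypic k ρ →
        ρ (psi k σ) w ∈ signIsotypic k ρ := by
      intro σ w hw
      rw [mem_signIsotypic_iff] at hw ⊢
      intro i
      have h1 := psi_mul_pairSwap σ (σ⁻¹ i)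
      rw [perm_apply_inv_apply] at h1
      rw [← Module.End.mul_apply, ← map_mul, h1, map_mul, Module.End.mul_apply, hw, map_neg]
    rcases hx with ⟨σ, rfl⟩ | ⟨i, rfl⟩
    · refine ⟨fun h1 => ?_, key σ v⟩
      have h2 := key σ⁻¹ _ h1
      rwa [← Module.End.mul_apply, ← map_mul, ← map_mul, inv_mul_cancel, map_one, map_one,
        Module.End.one_apply] at h2
    · have key' : ∀ w ∈ signIsotypic k ρ, ρ (pairSwap k i) w ∈ signIsotypic k ρ := by
        intro w hw
        rw [(mem_signIsotypic_iff ρ w).1 hw i]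
        exact Submodule.neg_mem _ hw
      refine ⟨fun h1 => ?_, key' v⟩
      have h2 := key' _ h1
      rwa [← Module.End.mul_apply, ← map_mul, pairSwap, Equiv.swap_mul_self, map_one,
        Module.End.one_apply] at h2
  | one => rw [map_one, Module.End.one_apply]
  | mul x y _ _ hx hy => rw [map_mul, Module.End.mul_apply, hx, hy]
  | inv x _ hx =>
    rw [← hx, ← Module.End.mul_apply, ← map_mul, mul_inv_cancel, map_one, Module.End.one_apply]

/-- The sign-isotypic part of the pair transpositions, as a representation of the hyperoctahedral
group. -/
def signIsotypicSub (k : ℕ) {V : Type*} [AddCommGroup V] [Module ℂ V]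
    (ρ : Representation ℂ (Equiv.Perm (Fin (2 * k))) V) :
    Subrepresentation (resRep ρ (hyperoctahedral k)) where
  toSubmodule := signIsotypic k ρ
  apply_mem_toSubmodule h v hv := (apply_mem_signIsotypic_iff ρ h.1 h.2 v).2 hv

/-- The inclusion of the Specht module into the space of tabloids. -/
noncomputable def spechtIncl (n : ℕ) (μ : YoungDiagram) :
    SpechtSpace n μ →ₗ[ℂ] ((Fin n → ℕ) →₀ ℂ) :=
  (spechtModule n μ).toSubmodule.subtype

theorem spechtIncl_injective (n : ℕ) (μ : YoungDiagram) : Function.Injective (spechtIncl n μ) :=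
  Subtype.val_injective

theorem spechtIncl_mem {n : ℕ} {μ : YoungDiagram} (v : SpechtSpace n μ) :
    spechtIncl n μ v ∈ (spechtModule n μ).toSubmodule :=
  Subtype.property (p := (· ∈ (spechtModule n μ).toSubmodule)) v

theorem spechtIncl_spechtRep {n : ℕ} {μ : YoungDiagram} (g : Equiv.Perm (Fin n))
    (v : SpechtSpace n μ) :
    spechtIncl n μ (spechtRep n μ g v) = tabloidRep n g (spechtIncl n μ v) := rfl

theorem exists_spechtIncl_eq {n : ℕ} {μ : YoungDiagram} {w : (Fin n → ℕ) →₀ ℂ}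
    (hw : w ∈ (spechtModule n μ).toSubmodule) : ∃ v, spechtIncl n μ v = w :=
  ⟨(⟨w, hw⟩ : (spechtModule n μ).toSubmodule), rfl⟩

variable {lam : YoungDiagram}

/-- The restriction of tabloids to the second elements of the pairs, between Specht modules. -/
noncomputable def spechtPairRestrict (hlam : lam.card = k) :
    SpechtSpace (2 * k) (YoungDiagram.consRow k lam) →ₗ[ℂ] SpechtSpace k lam :=
  LinearMap.codRestrict (spechtModule k lam).toSubmodule
    (pairRestrict k ∘ₗ spechtIncl (2 * k) (YoungDiagram.consRow k lam))
    fun v => pairRestrict_mem_spechtModule hlam (spechtIncl_mem v)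

theorem spechtIncl_spechtPairRestrict (hlam : lam.card = k)
    (v : SpechtSpace (2 * k) (YoungDiagram.consRow k lam)) :
    spechtIncl k lam (spechtPairRestrict hlam v) =
      pairRestrict k (spechtIncl (2 * k) (YoungDiagram.consRow k lam) v) := rfl

/-- Equivariance of a linear map on a stable subspace can be checked on generators of the group. -/
theorem equivariant_of_closure_eq_top {G V W : Type*} [Group G] [AddCommGroup V] [Module ℂ V]
    [AddCommGroup W] [Module ℂ W] (ρ : Representation ℂ G V) (τ : Representation ℂ G W)
    (f : V →ₗ[ℂ] W) (Q : Submodule ℂ V) (hQ : ∀ g, ∀ v ∈ Q, ρ g v ∈ Q) {S : Set G}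
    (hS : Subgroup.closure S = ⊤) (h : ∀ g ∈ S, ∀ v ∈ Q, f (ρ g v) = τ g (f v)) (g : G) :
    ∀ v ∈ Q, f (ρ g v) = τ g (f v) := by
  have hg : g ∈ Subgroup.closure S := hS ▸ Subgroup.mem_top g
  induction hg using Subgroup.closure_induction with
  | mem x hx => exact h x hx
  | one =>
    intro v _
    rw [map_one, map_one, Module.End.one_apply, Module.End.one_apply]
  | mul x y _ _ hx hy =>
    intro v hv
    rw [map_mul, map_mul, Module.End.mul_apply, Module.End.mul_apply, hx _ (hQ y v hv), hy v hv]
  | inv x _ hx =>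
    intro v hv
    have h1 := hx _ (hQ x⁻¹ v hv)
    rw [← Module.End.mul_apply, ← map_mul, mul_inv_cancel, map_one, Module.End.one_apply] at h1
    rw [h1, ← Module.End.mul_apply, ← map_mul, inv_mul_cancel, map_one, Module.End.one_apply]

theorem spechtPairRestrict_equivariant (hlam : lam.card = k) (h : hyperoctahedral k)
    (v : SpechtSpace (2 * k) (YoungDiagram.consRow k lam))
    (hv : v ∈ signIsotypic k (spechtRep (2 * k) (YoungDiagram.consRow k lam))) :
    spechtPairRestrict hlam
        (resRep (spechtRep (2 * k) (YoungDiagram.consRow k lam)) (hyperoctahedral k) h v) =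
      hyperoctahedralRep k lam h (spechtPairRestrict hlam v) := by
  refine equivariant_of_closure_eq_top _ _ _ _
    (fun g w hw => (apply_mem_signIsotypic_iff _ g.1 g.2 w).2 hw)
    (Subgroup.closure_closure_coe_preimage
      (k := Set.range (psi k) ∪ Set.range (pairSwap k))) ?_ h v hv
  rintro ⟨x, hx'⟩ hx w hw
  rcases hx with ⟨σ, rfl⟩ | ⟨i, rfl⟩
  · refine Eq.trans ?_ (LinearMap.congr_fun (hyperoctahedralRep_psi lam σ) _).symm
    refine spechtIncl_injective _ _ ?_
    rw [spechtIncl_spechtRep, spechtIncl_spechtPairRestrict, spechtIncl_spechtPairRestrict,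
      ← pairRestrict_psi, ← spechtIncl_spechtRep]
    rfl
  · refine Eq.trans ?_ (hyperoctahedralRep_pairSwap lam i _).symm
    rw [← map_neg, ← (mem_signIsotypic_iff _ w).1 hw i]
    rfl

/-- The sign-isotypic part of the pair transpositions in the Specht module of the diagram
`(k, lam)` is the representation of the hyperoctahedral group attached to `lam`. -/
theorem nonempty_signIsotypicSub_equiv (hlam : lam.card = k) :
    Nonempty ((signIsotypicSub k
      (spechtRep (2 * k) (YoungDiagram.consRow k lam))).toRepresentation.Equiv
        (hyperoctahedralRep k lam)) := by
  have hirr := hyperoctahedralRep_isIrreducible hlam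
  let f : (signIsotypicSub k
      (spechtRep (2 * k) (YoungDiagram.consRow k lam))).toRepresentation.IntertwiningMap
        (hyperoctahedralRep k lam) :=
    { toLinearMap := spechtPairRestrict hlam ∘ₗ Submodule.subtype _
      isIntertwining' := fun h => by
        ext1 v
        exact spechtPairRestrict_equivariant hlam h v.1 v.2 }
  have hf : ∀ v, f v = spechtPairRestrict hlam v.1 := fun v => rfl
  have hinj : ∀ v, f v = 0 → v = 0 := by
    intro v hv
    refine Subtype.ext (spechtIncl_injective _ _ ?_)
    refine (eq_zero_of_pairRestrict_eq_zero (spechtIncl_mem v.1) (fun i => ?_) ?_).trans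
      (map_zero _).symm
    · rw [← spechtIncl_spechtRep, (mem_signIsotypic_iff _ v.1).1 v.2 i, map_neg]
    · rw [← spechtIncl_spechtPairRestrict hlam, ← hf, hv, map_zero]
  have hne : f ≠ 0 := by
    intro h0
    obtain ⟨w, hw, hsign, hw0⟩ := exists_sign_vector hlam
    obtain ⟨v, rfl⟩ := exists_spechtIncl_eq hw
    have hv : v ∈ signIsotypic k (spechtRep (2 * k) (YoungDiagram.consRow k lam)) :=
      (mem_signIsotypic_iff _ v).2 fun i => spechtIncl_injective _ _ (by
        rw [spechtIncl_spechtRep, hsign, map_neg])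
    have h1 := hinj ⟨v, hv⟩ (by rw [h0]; rfl)
    refine hw0 ?_
    rw [show v = 0 from congrArg Subtype.val h1, map_zero]
  refine ⟨f.ofBijective ⟨?_, ?_⟩⟩
  · exact (injective_iff_map_eq_zero f).2 hinj
  · exact (Representation.IsIrreducible.surjective_or_eq_zero f).resolve_right hne

end Hyperoctahedral

/-! ### Multiplicity one -/

section Multiplicity

variable {G V W : Type*} [Group G] [AddCommGroup V] [Module ℂ V] [AddCommGroup W] [Module ℂ W]

theorem Subrepresentation.toSubmodule_ne_bot_of_isIrreducible {ρ : Representation ℂ G V}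
    {P : Subrepresentation ρ} (h : P.toRepresentation.IsIrreducible) : P.toSubmodule ≠ ⊥ := by
  intro h0
  have hnt := h.toNontrivial
  refine bot_ne_top (α := Subrepresentation P.toRepresentation)
    (Subrepresentation.toSubmodule_injective ?_)
  change (⊥ : Submodule ℂ P.toSubmodule) = ⊤
  refine (Submodule.eq_bot_iff _).2 (fun v _ => Subtype.ext ?_) |>.symm
  exact (Submodule.eq_bot_iff _).1 h0 v.1 v.2

/-- The preimage of a subrepresentation under an intertwining map. -/
def Subrepresentation.comap {ρ : Representation ℂ G V} {τ : Representation ℂ G W}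
    (f : ρ.IntertwiningMap τ) (U : Subrepresentation τ) : Subrepresentation ρ where
  toSubmodule := U.toSubmodule.comap f.toLinearMap
  apply_mem_toSubmodule g v hv := by
    change f (ρ g v) ∈ U.toSubmodule
    rw [Representation.IntertwiningMap.isIntertwining ρ τ f g v]
    exact U.apply_mem_toSubmodule g hv

theorem isIrreducible_of_equiv {ρ : Representation ℂ G V} {τ : Representation ℂ G W}
    (e : ρ.Equiv τ) (h : τ.IsIrreducible) : ρ.IsIrreducible := by
  have h1 (v : V) : e.symm.toIntertwiningMap (e.toIntertwiningMap v) = v :=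
    e.toLinearEquiv.symm_apply_apply v
  have h2 (w : W) : e.toIntertwiningMap (e.symm.toIntertwiningMap w) = w :=
    e.toLinearEquiv.apply_symm_apply w
  let f : Subrepresentation ρ ≃o Subrepresentation τ :=
    { toFun := Subrepresentation.comap e.symm.toIntertwiningMap
      invFun := Subrepresentation.comap e.toIntertwiningMap
      left_inv := fun U => Subrepresentation.toSubmodule_injective <| Submodule.ext fun v => by
        change e.symm.toIntertwiningMap (e.toIntertwiningMap v) ∈ U.toSubmodule ↔ _
        rw [h1]
      right_inv := fun U => Subrepresentation.toSubmodule_injective <| Submodule.ext fun v => by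
        change e.toIntertwiningMap (e.symm.toIntertwiningMap v) ∈ U.toSubmodule ↔ _
        rw [h2]
      map_rel_iff' := fun {U U'} => by
        refine ⟨fun hU v hv => ?_, fun hU w hw => hU hw⟩
        have h3 : e.symm.toIntertwiningMap (e.toIntertwiningMap v) ∈ U'.toSubmodule := by
          refine hU (x := e.toIntertwiningMap v) ?_
          change e.symm.toIntertwiningMap (e.toIntertwiningMap v) ∈ U.toSubmodule
          rw [h1]
          exact hv
        rwa [h1] at h3 }
  exact f.isSimpleOrder_iff.2 h

theorem exists_isIrreducible_le [FiniteDimensional ℂ V] {ρ : Representation ℂ G V}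
    (P : Subrepresentation ρ) (hP : P.toSubmodule ≠ ⊥) :
    ∃ U : Subrepresentation ρ, U.toSubmodule ≤ P.toSubmodule ∧
      U.toRepresentation.IsIrreducible := by
  classical
  have hex : ∃ n, ∃ U : Subrepresentation ρ, U.toSubmodule ≤ P.toSubmodule ∧
      U.toSubmodule ≠ ⊥ ∧ Module.finrank ℂ U.toSubmodule = n := ⟨_, P, le_rfl, hP, rfl⟩
  obtain ⟨U, hUP, hU0, hUn⟩ := Nat.find_spec hex
  refine ⟨U, hUP, Subrepresentation.isIrreducible_toRepresentation U hU0 fun Q hQ => ?_⟩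
  by_cases hQ0 : Q.toSubmodule = ⊥
  · exact Or.inl hQ0
  · have h1 : Nat.find hex ≤ Module.finrank ℂ Q.toSubmodule :=
      Nat.find_min' hex ⟨Q, hQ.trans hUP, hQ0, rfl⟩
    exact Or.inr (Submodule.eq_of_le_of_finrank_le hQ (hUn.le.trans h1)).ge

theorem Subrepresentation.toSubmodule_finset_sup {ρ : Representation ℂ G V}
    (s : Finset (Subrepresentation ρ)) :
    (s.sup id).toSubmodule = s.sup Subrepresentation.toSubmodule :=
  Finset.apply_sup_eq_sup_comp Subrepresentation.toSubmodule (fun _ _ => rfl) rfl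

/-- Every irreducible subrepresentation is a summand of a decomposition into irreducible
subrepresentations. -/
theorem exists_decomposition [Finite G] [FiniteDimensional ℂ V] {ρ : Representation ℂ G V}
    (Q : Subrepresentation ρ) (hQ : Q.toRepresentation.IsIrreducible) :
    ∃ s : Finset (Subrepresentation ρ), Q ∈ s ∧ (∀ U ∈ s, U.toRepresentation.IsIrreducible) ∧
      s.SupIndep Subrepresentation.toSubmodule ∧ s.sup Subrepresentation.toSubmodule = ⊤ := by
  classical
  let p : ℕ → Prop := fun n => ∃ s : Finset (Subrepresentation ρ), Q ∈ s ∧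
    (∀ U ∈ s, U.toRepresentation.IsIrreducible) ∧ s.SupIndep Subrepresentation.toSubmodule ∧
      Module.finrank ℂ (s.sup Subrepresentation.toSubmodule : Submodule ℂ V) = n
  have hp : p (Module.finrank ℂ Q.toSubmodule) := by
    refine ⟨{Q}, Finset.mem_singleton_self Q, fun U hU => ?_, Finset.supIndep_singleton _ _, ?_⟩
    · rwa [Finset.mem_singleton.1 hU]
    · rw [Finset.sup_singleton]
  have hbound : Module.finrank ℂ Q.toSubmodule ≤ Module.finrank ℂ V := Submodule.finrank_le _
  -- An independent family of irreducible subrepresentations with the largest possible sum. If the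
  -- sum were not everything, then a complement would contain a further irreducible one.
  obtain ⟨s, hQs, hirr, hind, hrank⟩ := Nat.findGreatest_spec hbound hp
  refine ⟨s, hQs, hirr, hind, ?_⟩
  by_contra htop
  obtain ⟨C, hC⟩ := ComplementedLattice.exists_isCompl (s.sup id)
  have hdisj : Disjoint (s.sup Subrepresentation.toSubmodule) C.toSubmodule := by
    rw [← Subrepresentation.toSubmodule_finset_sup, disjoint_iff]
    exact congrArg Subrepresentation.toSubmodule hC.inf_eq_bot
  have hC0 : C.toSubmodule ≠ ⊥ := by
    intro h0
    have h1 := congrArg Subrepresentation.toSubmodule hC.sup_eq_top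
    rw [Subrepresentation.toSubmodule_sup, h0, sup_bot_eq,
      Subrepresentation.toSubmodule_finset_sup] at h1
    exact htop h1
  obtain ⟨U, hUC, hU⟩ := exists_isIrreducible_le C hC0
  have hU0 := Subrepresentation.toSubmodule_ne_bot_of_isIrreducible hU
  have hdisj' := hdisj.mono_right hUC
  have hlt : s.sup Subrepresentation.toSubmodule <
      (insert U s).sup Subrepresentation.toSubmodule := by
    rw [Finset.sup_insert]
    refine lt_of_le_of_ne le_sup_right fun h => hU0 ?_
    exact hdisj'.eq_bot_of_ge (h ▸ le_sup_left)
  have h1 : p (Module.finrank ℂ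
      ((insert U s).sup Subrepresentation.toSubmodule : Submodule ℂ V)) :=
    ⟨insert U s, Finset.mem_insert_of_mem hQs, fun U' hU' => by
      rcases Finset.mem_insert.1 hU' with rfl | h
      · exact hU
      · exact hirr U' h, hind.insert hdisj'.symm, rfl⟩
  have h2 := Nat.le_findGreatest (Submodule.finrank_le _) h1
  have h3 := Submodule.finrank_lt_finrank_of_lt hlt
  rw [hrank] at h3
  exact absurd h2 (not_le.2 h3)

/-- If an irreducible representation `τ` is isomorphic to a subrepresentation `Q` that contains all
subrepresentations isomorphic to `τ`, then it occurs with multiplicity one. -/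
theorem occursWithMultiplicity_one [Finite G] [FiniteDimensional ℂ V] {ρ : Representation ℂ G V}
    {τ : Representation ℂ G W} (hτ : τ.IsIrreducible) (Q : Subrepresentation ρ)
    (e : Nonempty (Q.toRepresentation.Equiv τ))
    (hQ : ∀ U : Subrepresentation ρ, Nonempty (U.toRepresentation.Equiv τ) →
      U.toSubmodule ≤ Q.toSubmodule) : OccursWithMultiplicity τ ρ 1 := by
  classical
  obtain ⟨s, hQs, hirr, hind, htop⟩ :=
    exists_decomposition Q (isIrreducible_of_equiv e.some hτ)
  refine ⟨s.card, fun i => (s.equivFin.symm i).1, ?_, fun i => hirr _ (s.equivFin.symm i).2, ?_⟩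
  · refine DirectSum.isInternal_submodule_of_iSupIndep_of_iSup_eq_top ?_ ?_
    · exact ((iSupIndep_comp_coe_iff_supIndep).2 hind).comp s.equivFin.symm.injective
    · rw [s.equivFin.symm.iSup_comp (g := fun U : s => U.1.toSubmodule), ← htop,
        Finset.sup_eq_iSup, iSup_subtype]
  · rw [Nat.card_eq_one_iff_unique]
    refine ⟨⟨fun i j => ?_⟩, ⟨⟨s.equivFin ⟨Q, hQs⟩, ?_⟩⟩⟩
    · have key : ∀ i : {i : Fin s.card // Nonempty
          (((s.equivFin.symm i).1 : Subrepresentation ρ).toRepresentation.Equiv τ)},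
          (s.equivFin.symm i.1).1 = Q := by
        intro i
        by_contra hne
        have h1 := hind.pairwiseDisjoint (s.equivFin.symm i.1).2 hQs hne
        exact Subrepresentation.toSubmodule_ne_bot_of_isIrreducible
          (hirr _ (s.equivFin.symm i.1).2) (h1.eq_bot_of_le (hQ _ i.2))
      exact Subtype.ext (s.equivFin.symm.injective (Subtype.ext ((key i).trans (key j).symm)))
    · change Nonempty ((s.equivFin.symm (s.equivFin ⟨Q, hQs⟩)).1.toRepresentation.Equiv τ)
      rw [Equiv.symm_apply_apply]
      exact e

end Multiplicity

instance spechtSpace_finiteDimensional (n : ℕ) (μ : YoungDiagram) :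
    FiniteDimensional ℂ (SpechtSpace n μ) :=
  FiniteDimensional.span_of_finite ℂ (Set.finite_range
    fun t : Fin n ≃ {c // c ∈ μ.cells} => polytabloid t)

/-- The pair transpositions act by the sign on each copy of `W^{∅, lam}`, so that all copies lie in
the sign-isotypic part, which is itself such a copy. -/
theorem occursWithMultiplicity_hyperoctahedralRep {k : ℕ} {lam : YoungDiagram}
    (hlam : lam.card = k) :
    OccursWithMultiplicity (hyperoctahedralRep k lam)
      (resRep (spechtRep (2 * k) (YoungDiagram.consRow k lam)) (hyperoctahedral k)) 1 := by
  refine occursWithMultiplicity_one (hyperoctahedralRep_isIrreducible hlam) _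
    (nonempty_signIsotypicSub_equiv hlam) ?_
  rintro U ⟨e⟩ v hv
  refine (mem_signIsotypic_iff _ v).2 fun i => ?_
  let h : hyperoctahedral k := ⟨pairSwap k i, pairSwap_mem_hyperoctahedral i⟩
  have h1 : e (U.toRepresentation h ⟨v, hv⟩) = e (-⟨v, hv⟩) := by
    refine (Representation.IntertwiningMap.isIntertwining U.toRepresentation
      (hyperoctahedralRep k lam) e.toIntertwiningMap h ⟨v, hv⟩).trans ?_
    rw [hyperoctahedralRep_pairSwap]
    exact (map_neg e.toLinearEquiv (⟨v, hv⟩ : U.toSubmodule)).symm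
  exact congrArg Subtype.val (e.toLinearEquiv.injective h1)

theorem mainTheorem3 (k : ℕ) (lam : YoungDiagram) (hlam : lam.card = k) :
    (hyperoctahedralRep k lam).IsIrreducible ∧
    OccursWithMultiplicity (hyperoctahedralRep k lam)
      (resRep (spechtRep (2 * k) (plusDiagram lam (2 * k) (by rw [hlam]))) (hyperoctahedral k)) 1 ∧
    (∃ c : YoungDiagram →₀ ℤ,
      IsSchurExpansion
        (fun N => plethysm (schurPoly lam) (MvPolynomial.esymm (Fin N) ℕ 2)) c ∧
      (∀ c' : YoungDiagram →₀ ℤ,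
        IsSchurExpansion
          (fun N => plethysm (schurPoly lam) (MvPolynomial.esymm (Fin N) ℕ 2)) c' → c' = c) ∧
      c (plusDiagram lam (2 * k) (by rw [hlam])) = 1) ∧
    Module.finrank ℂ
        (signIsotypic k (spechtRep (2 * k) (plusDiagram lam (2 * k) (by rw [hlam])))) =
      Module.finrank ℂ (SpechtSpace k lam) := by
  have hplus : plusDiagram lam (2 * k) (by rw [hlam]) = YoungDiagram.consRow k lam := by
    rw [plusDiagram_eq_consRow, hlam, two_mul, Nat.add_sub_cancel]
  rw [hplus]
  refine ⟨hyperoctahedralRep_isIrreducible hlam, occursWithMultiplicity_hyperoctahedralRep hlam,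
    ?_, ?_⟩
  · have h1 := plethysm_expansion lam
    rwa [hlam] at h1
  · obtain ⟨e⟩ := nonempty_signIsotypicSub_equiv hlam
    exact e.toLinearEquiv.finrank_eq
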